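/- A dagger category is a category with an identity-on-objects, involutive, contravariant operation $f \mapsto f^\dagger$ on morphisms; a dagger isomorphism is an isomorphism $f$ with $f^{-1} = f^\dagger$. A dagger symmetric monoidal category is a dagger category with a symmetric monoidal structure such that $(f \otimes g)^\dagger = f^\dagger \otimes g^\dagger$ and the associators, unitors and braidings $\beta$ are dagger isomorphisms. It is dagger compact closed if for each object $X$ there are an object $X^*$ and a morphism $\eta_X : I \to X^* \otimes X$ such that $\eta_X$ and $\eta_X^\dagger \circ \beta_{X, X^*} : X \otimes X^* \to I$ are the unit and the counit of a duality, i.e., satisfy the triangle identities. A dagger biproduct of a family $(X_m)_{m \in M}$ is an object $\bigoplus_m X_m$ with morphisms $\mathrm{inc}_m : X_m \to \bigoplus_m X_m$ that make it a coproduct, whose daggers make it a product, and which satisfy $\mathrm{inc}_m^\dagger \circ \mathrm{inc}_m = \mathrm{id}$ and $\mathrm{inc}_m^\dagger \circ \mathrm{inc}_n = 0$ for $m \neq n$. Let $(\mathbf{C}, \otimes, I, \dagger)$ be a (locally small) dagger compact closed category such that (1') each (small) family of objects has a dagger biproduct (in particular there is a zero object); (2') $I$ is simple (a monomorphism into $I$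 is an isomorphism if and only if it is nonzero) and separating (the morphisms $I \to X$ are jointly epic for every object $X$); (3') each object $X$ has a unique morphism $\top_X : I \to X$ with $\mathrm{coker}(\top_X) = 0$; (4') for each morphism $a : I \to X$ there are objects $A$, $B$ and a dagger isomorphism $i : A \oplus B \to X$ such that $a = i \circ \mathrm{inc}_1 \circ \top_A$. For parallel morphisms $r, s : X \to Y$ let $r + s = \Delta_Y^\dagger \circ (r \oplus s) \circ \Delta_X$, where $\Delta_X : X \to X \oplus X$ is the diagonal, and write $r \leq s$ if $r + s = s$. For each object $X$, let $E(X)$ be the set of atoms of $\mathbf{C}(I, X)$, i.e., of nonzero $x : I \to X$ such that $y \le x$ implies $y = 0$ or $y = x$; for each morphism $r : X \to Y$, let $E(r) = \{(x, y) \in E(X) \times E(Y) \mid y^\dagger \circ r \circ x = \mathrm{id}_I\}$. Then $E$ is a strong symmetric monoidal dagger equivalence from $(\mathbf{C}, \otimes, I, \dagger)$ to the category $(\mathbf{Rel}, \times, \{\ast\}, \dagger)$ of sets and binary relations, with the converse of a relation as its dagger. That is: $E$ is a functor; $E(r^\dagger) = E(r)^\dagger$ for all $r$; $E$ is full and faithful;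 every set is dagger isomorphic to $E(X)$ for some object $X$; and $E$ is a strong symmetric monoidal functor whose structure morphisms, which are dagger isomorphisms, are the functions $\{\ast\} \to E(I)$, $\ast \mapsto \mathrm{id}_I$, and $E(X) \times E(Y) \to E(X \otimes Y)$, $(x, y) \mapsto x \otimes y$ (where $x \otimes y$ is precomposed with the unitor $I \cong I \otimes I$). Conversely, $(\mathbf{Rel}, \times, \{\ast\}, \dagger)$ is a dagger compact closed category that satisfies (1')-(4'). -/

import Mathlib

open CategoryTheory MonoidalCategory Limits

universe v u

/-! ## Dagger categories -/

/-- A dagger category: a category with an involutive, identity-on-objects, contravariant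
operation on morphisms. -/
class DaggerCategory (C : Type u) [Category.{v} C] where
  dag : ∀ {X Y : C}, (X ⟶ Y) → (Y ⟶ X)
  dag_id : ∀ X : C, dag (𝟙 X) = 𝟙 X
  dag_dag : ∀ {X Y : C} (f : X ⟶ Y), dag (dag f) = f
  dag_comp : ∀ {X Y Z : C} (f : X ⟶ Y) (g : Y ⟶ Z), dag (f ≫ g) = dag g ≫ dag f

open DaggerCategory (dag)

section Dagger

variable {C : Type u} [Category.{v} C] [DaggerCategory C]

/-- A dagger isomorphism: a morphism whose dagger is a two-sided inverse. -/
def IsDaggerIso {X Y : C} (f : X ⟶ Y) : Prop :=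
  f ≫ dag f = 𝟙 X ∧ dag f ≫ f = 𝟙 Y

/-- A dagger biproduct of a family of objects: an object that is a coproduct via the injections
and a product via their daggers, the injections being dagger monic and pairwise orthogonal. -/
structure DaggerBiproduct [HasZeroMorphisms C] {M : Type v} (X : M → C) where
  pt : C
  inj : ∀ m, X m ⟶ pt
  isColimit : IsColimit (Cofan.mk pt inj)
  isLimit : IsLimit (Fan.mk pt (fun m => dag (inj m)))
  inj_dag_self : ∀ m, inj m ≫ dag (inj m) = 𝟙 (X m)
  inj_dag_of_ne : ∀ m n, m ≠ n → inj m ≫ dag (inj n) = 0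

/-- The two-membered family `A, B`, indexed by `false, true`. -/
def pairFamily (A B : C) : ULift.{v} Bool → C :=
  fun b => match b with
    | ⟨false⟩ => A
    | ⟨true⟩ => B

/-- A dagger biproduct `A ⊕ B` of two objects. -/
abbrev BinaryDaggerBiproduct [HasZeroMorphisms C] (A B : C) :=
  DaggerBiproduct (pairFamily A B)

/-- The first inclusion `A ⟶ A ⊕ B`. -/
def BinaryDaggerBiproduct.inc₁ [HasZeroMorphisms C] {A B : C} (P : BinaryDaggerBiproduct A B) :
    A ⟶ P.pt :=
  P.inj ⟨false⟩

/-- The second inclusion `B ⟶ A ⊕ B`. -/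
def BinaryDaggerBiproduct.inc₂ [HasZeroMorphisms C] {A B : C} (P : BinaryDaggerBiproduct A B) :
    B ⟶ P.pt :=
  P.inj ⟨true⟩

end Dagger

/-- Every (small) family of objects has a dagger biproduct. -/
class HasDaggerBiproducts (C : Type u) [Category.{v} C] [DaggerCategory C]
    [HasZeroMorphisms C] : Prop where
  exists_biproduct : ∀ {M : Type v} (X : M → C), Nonempty (DaggerBiproduct X)

section Sums

variable {C : Type u} [Category.{v} C] [DaggerCategory C] [HasZeroMorphisms C]

/-- The diagonal `X ⟶ ⨁ X` into a biproduct of copies of `X`. -/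
def DaggerBiproduct.diag {M : Type v} {X : C} (P : DaggerBiproduct (fun _ : M => X)) :
    X ⟶ P.pt :=
  Fan.IsLimit.lift P.isLimit (fun _ => 𝟙 X)

/-- The morphism `⨁ rₘ` between biproducts induced by a family of morphisms. -/
def DaggerBiproduct.map {M : Type v} {X Y : M → C} (P : DaggerBiproduct X)
    (Q : DaggerBiproduct Y) (r : ∀ m, X m ⟶ Y m) : P.pt ⟶ Q.pt :=
  Cofan.IsColimit.desc P.isColimit (fun m => r m ≫ Q.inj m)

variable [HasDaggerBiproducts C]

/-- A choice of dagger biproduct of a family. -/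
noncomputable def biprodOf {M : Type v} (X : M → C) : DaggerBiproduct X :=
  Classical.choice (HasDaggerBiproducts.exists_biproduct X)

/-- The sum of a family of parallel morphisms: the diagonal, followed by the biproduct of the
family, followed by the dagger of the diagonal. -/
noncomputable def homSum {M : Type v} {X Y : C} (r : M → (X ⟶ Y)) : X ⟶ Y :=
  (biprodOf (fun _ : M => X)).diag ≫
    DaggerBiproduct.map (biprodOf (fun _ : M => X)) (biprodOf (fun _ : M => Y)) r ≫
      dag (biprodOf (fun _ : M => Y)).diag

/-- The sum `r + s` of two parallel morphisms. -/
noncomputable def homAdd {X Y : C} (r s : X ⟶ Y) : X ⟶ Y :=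
  homSum (fun b : ULift.{v} Bool => match b with
    | ⟨false⟩ => r
    | ⟨true⟩ => s)

/-- The order on parallel morphisms: `r ≤ s` when `r + s = s`. -/
def HomLE {X Y : C} (r s : X ⟶ Y) : Prop :=
  homAdd r s = s

/-- A morphism is an atom of its hom-set when it is nonzero and the only morphisms below it are
`0` and itself. -/
def IsHomAtom {X Y : C} (x : X ⟶ Y) : Prop :=
  x ≠ 0 ∧ ∀ y : X ⟶ Y, HomLE y x → y = 0 ∨ y = x

end Sums

/-- A morphism has zero cokernel: some (equivalently, every) morphism to a zero object is a
cokernel of it. -/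
def HasZeroCokernel {C : Type u} [Category.{v} C] [HasZeroMorphisms C] {X Y : C}
    (f : X ⟶ Y) : Prop :=
  ∃ (Z : C) (q : Y ⟶ Z) (w : f ≫ q = 0), IsZero Z ∧ Nonempty (IsColimit (CokernelCofork.ofπ q w))

/-! ## Dagger compact closed categories -/

/-- A dagger symmetric monoidal category: the tensor product is a dagger functor and the
associators, unitors and braidings are dagger isomorphisms. -/
class DaggerSymmetricMonoidal (C : Type u) [Category.{v} C] [DaggerCategory C]
    [MonoidalCategory C] [SymmetricCategory C] : Prop where
  dag_tensor : ∀ {X₁ Y₁ X₂ Y₂ : C} (f : X₁ ⟶ Y₁) (g : X₂ ⟶ Y₂),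
    dag (f ⊗ₘ g) = dag f ⊗ₘ dag g
  associator_dag : ∀ X Y Z : C, IsDaggerIso (α_ X Y Z).hom
  leftUnitor_dag : ∀ X : C, IsDaggerIso (λ_ X).hom
  rightUnitor_dag : ∀ X : C, IsDaggerIso (ρ_ X).hom
  braiding_dag : ∀ X Y : C, IsDaggerIso (β_ X Y).hom

/-- `D` is a dagger dual of `X`: there are a coevaluation `η : I ⟶ D ⊗ X` and an evaluation
`X ⊗ D ⟶ I` that satisfy the triangle identities, the evaluation being the dagger of `η`
precomposed with the braiding. -/
def IsDaggerDual {C : Type u} [Category.{v} C] [DaggerCategory C]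
    [MonoidalCategory C] [SymmetricCategory C] (D X : C) : Prop :=
  ∃ p : ExactPairing D X, p.evaluation' = (β_ X D).hom ≫ dag p.coevaluation'

/-- A dagger compact closed category: a dagger symmetric monoidal category in which each object
has a dagger dual. -/
class DaggerCompactClosed (C : Type u) [Category.{v} C] [DaggerCategory C]
    [MonoidalCategory C] [SymmetricCategory C] : Prop extends DaggerSymmetricMonoidal C where
  exists_dual : ∀ X : C, ∃ D : C, IsDaggerDual D X

/-- Each morphism `a : I ⟶ X` factors as `⊤_A`, followed by the inclusion `A ⟶ A ⊕ B`, followed by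
a dagger isomorphism `A ⊕ B ⟶ X`. Here `⊤_A : I ⟶ A` denotes a morphism with zero cokernel. -/
def UnitMorphismsFactor (C : Type u) [Category.{v} C] [DaggerCategory C]
    [MonoidalCategory C] [HasZeroMorphisms C] : Prop :=
  ∀ (X : C) (a : 𝟙_ C ⟶ X), ∃ (A B : C) (P : BinaryDaggerBiproduct A B) (i : P.pt ⟶ X)
    (t : 𝟙_ C ⟶ A), IsDaggerIso i ∧ HasZeroCokernel t ∧ a = t ≫ P.inc₁ ≫ i

/-- A dagger equivalence: a full and faithful dagger functor such that every object of the target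
is dagger isomorphic to an object in the image. -/
structure IsDaggerEquivalence {C : Type*} {D : Type*} [Category C] [Category D]
    [DaggerCategory C] [DaggerCategory D] (F : C ⥤ D) : Prop where
  map_dag : ∀ {X Y : C} (f : X ⟶ Y), F.map (dag f) = dag (F.map f)
  full : F.Full
  faithful : F.Faithful
  surj : ∀ S : D, ∃ (X : C) (i : F.obj X ⟶ S), IsDaggerIso i

/-! ## The dagger symmetric monoidal category of sets and relations -/

namespace RelSets

/-- The underlying type of an object of `RelCat`. -/
abbrev carrier (X : RelCat.{v}) : Type v := X

/-- The object of `RelCat` given by a type. -/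
abbrev of (X : Type v) : RelCat.{v} := X

/-- The morphism of `RelCat` given by a binary relation. -/
def mk {X Y : RelCat.{v}} (r : carrier X → carrier Y → Prop) : X ⟶ Y :=
  RelCat.Hom.ofRel (X := X) (Y := Y) {p | r p.1 p.2}

/-- The binary relation underlying a morphism of `RelCat`. -/
def rel {X Y : RelCat.{v}} (f : X ⟶ Y) (x : carrier X) (y : carrier Y) : Prop :=
  (x, y) ∈ RelCat.Hom.rel f

theorem hom_ext {X Y : RelCat.{v}} {f g : X ⟶ Y} (h : ∀ x y, rel f x y ↔ rel g x y) : f = g :=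
  RelCat.Hom.ext f g (Set.ext fun p => h p.1 p.2)

@[simp] theorem rel_mk {X Y : RelCat.{v}} (r : carrier X → carrier Y → Prop) (x : carrier X)
    (y : carrier Y) : rel (mk r) x y ↔ r x y := Iff.rfl

@[simp] theorem rel_id {X : RelCat.{v}} (x y : carrier X) : rel (𝟙 X) x y ↔ x = y := Iff.rfl

@[simp] theorem rel_comp {X Y Z : RelCat.{v}} (f : X ⟶ Y) (g : Y ⟶ Z) (x : carrier X)
    (z : carrier Z) : rel (f ≫ g) x z ↔ ∃ y, rel f x y ∧ rel g y z := Iff.rfl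

/-- The graph of a bijection, as an isomorphism of `RelCat`. -/
def isoOfEquiv {X Y : RelCat.{v}} (e : carrier X ≃ carrier Y) : X ≅ Y where
  hom := mk fun x y => e x = y
  inv := mk fun y x => e x = y
  hom_inv_id := hom_ext fun x y => by simp [eq_comm]
  inv_hom_id := hom_ext fun x y => by
    simp only [rel_comp, rel_mk, rel_id]
    exact ⟨fun ⟨z, h, h'⟩ => h.symm.trans h', fun h => ⟨e.symm x, by simp [h]⟩⟩

/-- The dagger of a relation is its converse. -/
instance : DaggerCategory RelCat.{v} where
  dag f := mk fun y x => rel f x y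
  dag_id X := hom_ext fun x y => by simp [eq_comm]
  dag_dag f := rfl
  dag_comp f g := hom_ext fun x y => by simp [and_comm]

/-- The zero morphisms of `RelCat` are the empty relations. -/
instance : HasZeroMorphisms RelCat.{v} where
  zero _ _ := ⟨mk fun _ _ => False⟩
  comp_zero _ _ := hom_ext fun _ _ => ⟨fun ⟨_, _, h⟩ => h, fun h => h.elim⟩
  zero_comp _ _ _ _ := hom_ext fun _ _ => ⟨fun ⟨_, h, _⟩ => h, fun h => h.elim⟩

/-- The monoidal structure: the cartesian product of sets, with a singleton as the unit, and with
the usual bijections as associators and unitors. -/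
instance : MonoidalCategoryStruct RelCat.{v} where
  tensorObj X Y := of (carrier X × carrier Y)
  tensorUnit := of PUnit.{v + 1}
  tensorHom {X₁ Y₁ X₂ Y₂} f g :=
    mk (X := of (carrier X₁ × carrier X₂)) (Y := of (carrier Y₁ × carrier Y₂))
      fun p q => rel f p.1 q.1 ∧ rel g p.2 q.2
  whiskerLeft X {Y₁ Y₂} g :=
    mk (X := of (carrier X × carrier Y₁)) (Y := of (carrier X × carrier Y₂))
      fun p q => p.1 = q.1 ∧ rel g p.2 q.2
  whiskerRight {X₁ X₂} f Y :=
    mk (X := of (carrier X₁ × carrier Y)) (Y := of (carrier X₂ × carrier Y))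
      fun p q => rel f p.1 q.1 ∧ p.2 = q.2
  associator X Y Z := isoOfEquiv (Equiv.prodAssoc (carrier X) (carrier Y) (carrier Z))
  leftUnitor X := isoOfEquiv (Equiv.punitProd (carrier X))
  rightUnitor X := isoOfEquiv (Equiv.prodPUnit (carrier X))

@[simp] theorem rel_dag {X Y : RelCat.{v}} (f : X ⟶ Y) (y : carrier Y) (x : carrier X) :
    rel (dag f) y x ↔ rel f x y := Iff.rfl

@[simp] theorem rel_tensor {X₁ Y₁ X₂ Y₂ : RelCat.{v}} (f : X₁ ⟶ Y₁) (g : X₂ ⟶ Y₂)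
    (p : carrier X₁ × carrier X₂) (q : carrier Y₁ × carrier Y₂) :
    rel (f ⊗ₘ g) p q ↔ rel f p.1 q.1 ∧ rel g p.2 q.2 := Iff.rfl

@[simp] theorem rel_whiskerLeft (X : RelCat.{v}) {Y₁ Y₂ : RelCat.{v}} (g : Y₁ ⟶ Y₂)
    (p : carrier X × carrier Y₁) (q : carrier X × carrier Y₂) :
    rel (X ◁ g) p q ↔ p.1 = q.1 ∧ rel g p.2 q.2 := Iff.rfl

@[simp] theorem rel_whiskerRight {X₁ X₂ : RelCat.{v}} (f : X₁ ⟶ X₂) (Y : RelCat.{v})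
    (p : carrier X₁ × carrier Y) (q : carrier X₂ × carrier Y) :
    rel (f ▷ Y) p q ↔ rel f p.1 q.1 ∧ p.2 = q.2 := Iff.rfl

@[simp] theorem rel_associator_hom (X Y Z : RelCat.{v})
    (p : (carrier X × carrier Y) × carrier Z) (q : carrier X × carrier Y × carrier Z) :
    rel (α_ X Y Z).hom p q ↔ (p.1.1, p.1.2, p.2) = q := Iff.rfl

@[simp] theorem rel_associator_inv (X Y Z : RelCat.{v})
    (p : (carrier X × carrier Y) × carrier Z) (q : carrier X × carrier Y × carrier Z) :
    rel (α_ X Y Z).inv q p ↔ (p.1.1, p.1.2, p.2) = q := Iff.rfl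

@[simp] theorem rel_leftUnitor_hom (X : RelCat.{v}) (p : PUnit.{v + 1} × carrier X)
    (x : carrier X) : rel (λ_ X).hom p x ↔ p.2 = x := Iff.rfl

@[simp] theorem rel_rightUnitor_hom (X : RelCat.{v}) (p : carrier X × PUnit.{v + 1})
    (x : carrier X) : rel (ρ_ X).hom p x ↔ p.1 = x := Iff.rfl

theorem exists_carrier_tensor {X Y : RelCat.{v}} {P : carrier (X ⊗ Y) → Prop} :
    (∃ p, P p) ↔ ∃ (x : carrier X) (y : carrier Y), P (x, y) := Prod.exists

instance : MonoidalCategory RelCat.{v} where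
  tensorHom_def f g := by
    refine hom_ext ?_
    rintro ⟨a, b⟩ ⟨c, d⟩
    simp [exists_carrier_tensor]
  id_tensorHom_id X Y := by
    refine hom_ext ?_
    rintro ⟨a, b⟩ ⟨c, d⟩
    simp only [rel_tensor, rel_id]
    exact Prod.mk_inj.symm
  tensorHom_comp_tensorHom f₁ f₂ g₁ g₂ := by
    refine hom_ext ?_
    rintro ⟨a, b⟩ ⟨c, d⟩
    simp [exists_carrier_tensor]
    grind
  whiskerLeft_id X Y := by
    refine hom_ext ?_
    rintro ⟨a, b⟩ ⟨c, d⟩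
    simp only [rel_whiskerLeft, rel_id]
    exact Prod.mk_inj.symm
  id_whiskerRight X Y := by
    refine hom_ext ?_
    rintro ⟨a, b⟩ ⟨c, d⟩
    simp only [rel_whiskerRight, rel_id]
    exact Prod.mk_inj.symm
  associator_naturality f g h := by
    refine hom_ext ?_
    rintro ⟨⟨a, b⟩, c⟩ ⟨d, e, e'⟩
    simp [exists_carrier_tensor, and_assoc]
  leftUnitor_naturality f := by
    refine hom_ext ?_
    rintro ⟨a, b⟩ c
    simp [exists_carrier_tensor]
  rightUnitor_naturality f := by
    refine hom_ext ?_
    rintro ⟨a, b⟩ c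
    simp [exists_carrier_tensor]
  pentagon W X Y Z := by
    refine hom_ext ?_
    rintro ⟨⟨⟨a, b⟩, c⟩, d⟩ ⟨a', b', c', d'⟩
    simp [exists_carrier_tensor]
    exact fun _ _ => Prod.mk_inj.symm
  triangle X Y := by
    refine hom_ext ?_
    rintro ⟨⟨a, b⟩, c⟩ ⟨d, e⟩
    simp

/-- The bijection `X × Y → Y × X` that swaps the factors. -/
def swapIso (X Y : RelCat.{v}) : X ⊗ Y ≅ Y ⊗ X :=
  isoOfEquiv (Equiv.prodComm (carrier X) (carrier Y))

@[simp] theorem rel_swapIso_hom (X Y : RelCat.{v}) (p : carrier X × carrier Y)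
    (q : carrier Y × carrier X) : rel (swapIso X Y).hom p q ↔ p.2 = q.1 ∧ p.1 = q.2 :=
  Prod.ext_iff (x := p.swap) (y := q)

@[simp] theorem rel_swapIso_inv (X Y : RelCat.{v}) (p : carrier X × carrier Y)
    (q : carrier Y × carrier X) : rel (swapIso X Y).inv q p ↔ p.2 = q.1 ∧ p.1 = q.2 :=
  Prod.ext_iff (x := p.swap) (y := q)

/-- The braiding is the swap of factors. -/
instance : SymmetricCategory RelCat.{v} where
  braiding := swapIso
  braiding_naturality_right X Y Z f := by
    refine hom_ext ?_
    rintro ⟨a, b⟩ ⟨c, d⟩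
    simp [exists_carrier_tensor]
  braiding_naturality_left f Z := by
    refine hom_ext ?_
    rintro ⟨a, b⟩ ⟨c, d⟩
    simp [exists_carrier_tensor]
    grind
  hexagon_forward X Y Z := by
    refine hom_ext ?_
    rintro ⟨⟨a, b⟩, c⟩ ⟨d, e, f⟩
    simp [exists_carrier_tensor]
  hexagon_reverse X Y Z := by
    refine hom_ext ?_
    rintro ⟨a, b, c⟩ ⟨⟨d, e⟩, f⟩
    simp [exists_carrier_tensor]
    grind
  symmetry X Y := by
    refine hom_ext ?_
    rintro ⟨a, b⟩ ⟨c, d⟩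
    simp [exists_carrier_tensor]
    grind

end RelSets

/-! ## The functor of atoms -/

section Atoms

variable (C : Type u) [Category.{v} C] [DaggerCategory C] [HasZeroMorphisms C]
  [HasDaggerBiproducts C] [MonoidalCategory C]

variable {C} in
/-- `E(X)`: the set of atoms of `C(I, X)`. -/
def atomSet (X : C) : RelCat.{v} :=
  RelSets.of {x : 𝟙_ C ⟶ X // IsHomAtom x}

variable {C} in
/-- `E(r)`: the relation consisting of the pairs `(x, y)` of atoms with `y† ∘ r ∘ x = 1`. -/
def atomMap {X Y : C} (r : X ⟶ Y) : atomSet X ⟶ atomSet Y :=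
  RelSets.mk (X := atomSet X) (Y := atomSet Y)
    fun x y => x.1 ≫ r ≫ dag y.1 = 𝟙 (𝟙_ C)

/-- `E` as a functor, given that `atomMap` respects identities and composition. -/
def atomFunctor (hid : ∀ X : C, atomMap (𝟙 X) = 𝟙 (atomSet X))
    (hcomp : ∀ (X Y Z : C) (f : X ⟶ Y) (g : Y ⟶ Z), atomMap (f ≫ g) = atomMap f ≫ atomMap g) :
    C ⥤ RelCat.{v} where
  obj X := atomSet X
  map r := atomMap r
  map_id := hid
  map_comp f g := hcomp _ _ _ f g

/-- The relation `{∗} ⟶ E(I)` given by the function `∗ ↦ 1`. -/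
def atomUnit : 𝟙_ RelCat.{v} ⟶ atomSet (𝟙_ C) :=
  RelSets.mk (X := 𝟙_ RelCat.{v}) (Y := atomSet (𝟙_ C)) fun _ z => z.1 = 𝟙 (𝟙_ C)

variable {C} in
/-- The relation `E(X) × E(Y) ⟶ E(X ⊗ Y)` given by the function `(x, y) ↦ x ⊗ y`, where `x ⊗ y` is
regarded as a morphism out of `I` via the unitor `I ⊗ I ≅ I`. -/
def atomTensor (X Y : C) : atomSet X ⊗ atomSet Y ⟶ atomSet (X ⊗ Y) :=
  RelSets.mk (X := atomSet X ⊗ atomSet Y) (Y := atomSet (X ⊗ Y))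
    fun p z => z.1 = (λ_ (𝟙_ C)).inv ≫ (p.1.1 ⊗ₘ p.2.1)

end Atoms

/-!
The scalars `I ⟶ I` turn out to be the two Boolean truth values: biproducts make them a complete
idempotent semiring, and simplicity of `I` together with the factorisation of states leaves only
`0` and `1`. Hence the states `I ⟶ X` of each object are ordered by their sums, two states being
orthogonal exactly when nothing nonzero lies below both, and each state has a complement.

A nonzero state has an atom below it. Otherwise it splits off a summand `A` without atoms. By
compact closure the endomorphisms of `A` are the states of `[A, A]`, so the identity of `A` has a
complement there; evaluating this complement on states of `A` is only consistent if `A` is zero.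

Consequently the atoms of `X` form an orthonormal basis of states, and a morphism is determined by
its Boolean matrix in these bases, that is, by a relation; composition of matrices is composition of
relations. Tensor products of such bases are again bases, so the structure morphisms of the
monoidal structure are graphs of bijections.
-/

attribute [simp] DaggerCategory.dag_id DaggerCategory.dag_dag DaggerCategory.dag_comp

section DaggerCategory

variable {C : Type u} [Category.{v} C] [DaggerCategory C] {X Y : C}

theorem DaggerCategory.dag_injective : Function.Injective (dag : (X ⟶ Y) → (Y ⟶ X)) :=
  Function.LeftInverse.injective dag_dag

open DaggerCategory (dag_injective)

theorem IsDaggerIso.dag_inv {e : X ≅ Y} (h : IsDaggerIso e.hom) : dag e.inv = e.hom := by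
  rw [← (cancel_epi e.hom).1 (h.1.trans e.hom_inv_id.symm), DaggerCategory.dag_dag]

variable [HasZeroMorphisms C]

theorem dag_zero : dag (0 : X ⟶ Y) = 0 := by
  simpa only [zero_comp, DaggerCategory.dag_dag] using
    DaggerCategory.dag_comp (0 : X ⟶ Y) (dag (0 : Y ⟶ Y))

theorem dag_eq_zero_iff {f : X ⟶ Y} : dag f = 0 ↔ f = 0 := by
  rw [← dag_injective.eq_iff (a := f), dag_zero]

end DaggerCategory

open DaggerCategory (dag_injective)

namespace DaggerBiproduct

variable {C : Type u} [Category.{v} C] [DaggerCategory C] [HasZeroMorphisms C] {M : Type v}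

section

variable {X Y : M → C} {Z : C} (P : DaggerBiproduct X)

theorem hom_ext_inj {f g : P.pt ⟶ Z} (h : ∀ m, P.inj m ≫ f = P.inj m ≫ g) : f = g :=
  Cofan.IsColimit.hom_ext P.isColimit f g h

theorem hom_ext_dag_inj {f g : Z ⟶ P.pt}
    (h : ∀ m, f ≫ dag (P.inj m) = g ≫ dag (P.inj m)) : f = g :=
  Fan.IsLimit.hom_ext P.isLimit f g h

theorem inj_map (Q : DaggerBiproduct Y) (r : ∀ m, X m ⟶ Y m) (m : M) :
    P.inj m ≫ P.map Q r = r m ≫ Q.inj m :=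
  Cofan.IsColimit.fac P.isColimit _ m

theorem dag_map (Q : DaggerBiproduct Y)
    (r : ∀ m, X m ⟶ Y m) : dag (P.map Q r) = Q.map P fun m => dag (r m) := by
  refine Q.hom_ext_inj fun m => P.hom_ext_dag_inj fun n => ?_
  rw [Q.inj_map, Category.assoc, ← DaggerCategory.dag_comp, P.inj_map, DaggerCategory.dag_comp,
    Category.assoc]
  rcases eq_or_ne m n with rfl | h
  · rw [reassoc_of% Q.inj_dag_self, P.inj_dag_self, Category.comp_id]
  · rw [reassoc_of% Q.inj_dag_of_ne m n h, P.inj_dag_of_ne m n h, zero_comp, comp_zero]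

end

variable {X : C} (P : DaggerBiproduct fun _ : M => X)

theorem diag_dag_inj (m : M) : P.diag ≫ dag (P.inj m) = 𝟙 X :=
  Fan.IsLimit.fac P.isLimit _ m

theorem inj_dag_diag (m : M) : P.inj m ≫ dag P.diag = 𝟙 X :=
  dag_injective (by simpa using P.diag_dag_inj m)

end DaggerBiproduct

section HomSum

variable {C : Type u} [Category.{v} C] [DaggerCategory C] [HasZeroMorphisms C]
  [HasDaggerBiproducts C] {M N : Type v} {X Y Z : C}

theorem homSum_eq_diag_comp {r : M → (X ⟶ Y)} {f : (biprodOf fun _ : M => X).pt ⟶ Y}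
    (h : ∀ m, (biprodOf _).inj m ≫ f = r m) : homSum r = (biprodOf _).diag ≫ f := by
  unfold homSum
  congr 1
  refine (biprodOf _).hom_ext_inj fun m => ?_
  rw [reassoc_of% (biprodOf _).inj_map, DaggerBiproduct.inj_dag_diag, Category.comp_id, h]

theorem homSum_id (M : Type v) (X : C) : homSum (fun _ : M => 𝟙 X) =
    (biprodOf fun _ : M => X).diag ≫ dag (biprodOf fun _ : M => X).diag :=
  homSum_eq_diag_comp (DaggerBiproduct.inj_dag_diag _)

theorem homSum_comp (r : M → (X ⟶ Y)) (g : Y ⟶ Z) :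
    homSum r ≫ g = homSum fun m => r m ≫ g := by
  rw [homSum, Category.assoc]
  refine (homSum_eq_diag_comp fun m => ?_).symm
  rw [Category.assoc, reassoc_of% (biprodOf _).inj_map, reassoc_of% (biprodOf _).inj_dag_diag]

theorem dag_homSum (r : M → (X ⟶ Y)) : dag (homSum r) = homSum fun m => dag (r m) := by
  simp [homSum, DaggerBiproduct.dag_map]

theorem comp_homSum (f : X ⟶ Y) (r : M → (Y ⟶ Z)) :
    f ≫ homSum r = homSum fun m => f ≫ r m :=
  dag_injective (by simp [dag_homSum, homSum_comp])

theorem homSum_eq_single {r : M → (X ⟶ Y)} (m : M) (h : ∀ n, n ≠ m → r n = 0) :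
    homSum r = r m := by
  rw [homSum_eq_diag_comp (f := dag ((biprodOf _).inj m) ≫ r m),
    reassoc_of% (biprodOf _).diag_dag_inj]
  intro n
  rcases eq_or_ne n m with rfl | hn
  · rw [reassoc_of% (biprodOf _).inj_dag_self]
  · rw [reassoc_of% (biprodOf _).inj_dag_of_ne _ _ hn, zero_comp, h n hn]

theorem homSum_zero : homSum (fun _ : M => (0 : X ⟶ Y)) = 0 := by
  simpa using (homSum_comp (fun _ : M => 𝟙 X) (0 : X ⟶ Y)).symm

theorem homSum_comm (r : M → N → (X ⟶ Y)) :
    homSum (fun m => homSum (r m)) = homSum fun n => homSum fun m => r m n := by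
  -- Both sides are the diagonal into the `M`-fold biproduct followed by the sum of the `f n`.
  let P := biprodOf fun _ : M => X
  let f (n : N) : P.pt ⟶ Y := Cofan.IsColimit.desc P.isColimit fun m => r m n
  have hf (m : M) (n : N) : P.inj m ≫ f n = r m n := Cofan.IsColimit.fac P.isColimit _ m
  calc homSum (fun m => homSum (r m))
      = P.diag ≫ homSum f := homSum_eq_diag_comp fun m => by rw [comp_homSum]; simp only [P, hf]
    _ = homSum fun n => P.diag ≫ f n := comp_homSum _ _
    _ = homSum fun n => homSum fun m => r m n :=
        congrArg homSum (funext fun n => (homSum_eq_diag_comp fun m => hf m n).symm)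

theorem homAdd_eq_homSum (r : ULift.{v} Bool → (X ⟶ Y)) :
    homAdd (r ⟨false⟩) (r ⟨true⟩) = homSum r :=
  congrArg homSum (funext fun | ⟨false⟩ => rfl | ⟨true⟩ => rfl)

theorem homAdd_comp (r s : X ⟶ Y) (g : Y ⟶ Z) :
    homAdd r s ≫ g = homAdd (r ≫ g) (s ≫ g) := by
  rw [homAdd, homSum_comp, ← homAdd_eq_homSum]

theorem comp_homAdd (f : X ⟶ Y) (r s : Y ⟶ Z) :
    f ≫ homAdd r s = homAdd (f ≫ r) (f ≫ s) := by
  rw [homAdd, comp_homSum, ← homAdd_eq_homSum]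

theorem homAdd_zero (r : X ⟶ Y) : homAdd r 0 = r :=
  homSum_eq_single (ULift.up false) (by rintro ⟨_ | _⟩ h <;> simp_all)

theorem zero_homAdd (r : X ⟶ Y) : homAdd 0 r = r :=
  homSum_eq_single (ULift.up true) (by rintro ⟨_ | _⟩ h <;> simp_all)

theorem homSum_homAdd (r s : M → (X ⟶ Y)) :
    homSum (fun m => homAdd (r m) (s m)) = homAdd (homSum r) (homSum s) := by
  simp only [homAdd]
  rw [homSum_comm, ← homAdd_eq_homSum]
  rfl

theorem homAdd_homAdd_homAdd_comm (a b c d : X ⟶ Y) :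
    homAdd (homAdd a b) (homAdd c d) = homAdd (homAdd a c) (homAdd b d) := by
  have h := homSum_homAdd (fun i : ULift.{v} Bool => cond i.down c a) fun i => cond i.down d b
  simpa only [← homAdd_eq_homSum, cond_true, cond_false] using h

theorem isUnital_homAdd : EckmannHilton.IsUnital (homAdd : (X ⟶ Y) → _) 0 where
  left_id := zero_homAdd
  right_id := homAdd_zero

theorem homAdd_comm (r s : X ⟶ Y) : homAdd r s = homAdd s r :=
  (EckmannHilton.mul_comm isUnital_homAdd isUnital_homAdd homAdd_homAdd_homAdd_comm).comm r s

theorem homAdd_assoc (r s t : X ⟶ Y) : homAdd (homAdd r s) t = homAdd r (homAdd s t) :=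
  (EckmannHilton.mul_assoc isUnital_homAdd isUnital_homAdd homAdd_homAdd_homAdd_comm).assoc r s t

open Classical in
theorem homSum_eq_homAdd (r : M → (X ⟶ Y)) (m : M) :
    homSum r = homAdd (r m) (homSum fun n => if n = m then 0 else r n) := by
  calc homSum r
      = homSum fun n => homAdd (if n = m then r n else 0) (if n = m then 0 else r n) := by
        congr! with n
        split_ifs
        · rw [homAdd_zero]
        · rw [zero_homAdd]
    _ = homAdd (r m) (homSum fun n => if n = m then 0 else r n) := by
        rw [homSum_homAdd, homSum_eq_single m fun n hn => if_neg hn, if_pos rfl]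

theorem DaggerBiproduct.homSum_id {X : M → C} (P : DaggerBiproduct X) :
    homSum (fun m => dag (P.inj m) ≫ P.inj m) = 𝟙 P.pt := by
  refine P.hom_ext_inj fun n => ?_
  rw [comp_homSum, homSum_eq_single n fun m hm => ?_]
  · rw [reassoc_of% P.inj_dag_self, Category.comp_id]
  · rw [reassoc_of% P.inj_dag_of_ne _ _ hm.symm, zero_comp]

namespace BinaryDaggerBiproduct

variable {A B : C} (P : BinaryDaggerBiproduct A B)

theorem homAdd_id : homAdd (dag P.inc₁ ≫ P.inc₁) (dag P.inc₂ ≫ P.inc₂) = 𝟙 P.pt :=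
  (homAdd_eq_homSum fun m => dag (P.inj m) ≫ P.inj m).trans P.homSum_id

omit [HasDaggerBiproducts C] in
theorem inc₁_comp_dag_inc₁ : P.inc₁ ≫ dag P.inc₁ = 𝟙 A := P.inj_dag_self ⟨false⟩

omit [HasDaggerBiproducts C] in
theorem inc₁_comp_dag_inc₂ : P.inc₁ ≫ dag P.inc₂ = 0 :=
  P.inj_dag_of_ne ⟨false⟩ ⟨true⟩ (by simp)

end BinaryDaggerBiproduct

end HomSum

section ZeroCokernel

variable {C : Type u} [Category.{v} C] [DaggerCategory C] [HasZeroMorphisms C]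
  [HasDaggerBiproducts C] {X Y Z : C}

theorem exists_isZero (C : Type u) [Category.{v} C] [DaggerCategory C] [HasZeroMorphisms C]
    [HasDaggerBiproducts C] [Nonempty C] : ∃ Z : C, IsZero Z :=
  Nonempty.elim ‹_› fun X =>
    let P := biprodOf fun _ : PEmpty.{v + 1} => X
    ⟨P.pt, (IsZero.iff_id_eq_zero _).2 (P.hom_ext_inj fun m => m.elim)⟩

theorem hasZeroCokernel_iff {f : X ⟶ Y} :
    HasZeroCokernel f ↔ ∀ (Z : C) (q : Y ⟶ Z), f ≫ q = 0 → q = 0 := by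
  constructor
  · rintro ⟨Z, q, w, hZ, ⟨h⟩⟩ W g hg
    obtain ⟨l, hl⟩ := CokernelCofork.IsColimit.desc' h g hg
    rw [← hl, hZ.eq_zero_of_src l, comp_zero]
  · intro h
    have : Nonempty C := ⟨X⟩
    obtain ⟨Z, hZ⟩ := exists_isZero C
    refine ⟨Z, 0, comp_zero, hZ, ⟨CokernelCofork.IsColimit.ofπ _ _ (fun _ _ => 0) ?_ ?_⟩⟩
    · intro W g hg
      rw [h W g hg, comp_zero]
    · intro W g _ m _
      exact hZ.eq_zero_of_src m

theorem hasZeroCokernel_id (X : C) : HasZeroCokernel (𝟙 X) :=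
  hasZeroCokernel_iff.2 fun W q hq => by rwa [Category.id_comp] at hq

theorem HasZeroCokernel.comp_iso {f : X ⟶ Y} (hf : HasZeroCokernel f) (e : Y ⟶ Z) [IsIso e] :
    HasZeroCokernel (f ≫ e) :=
  hasZeroCokernel_iff.2 fun W q hq => by
    rw [← cancel_epi e, comp_zero]
    exact hasZeroCokernel_iff.1 hf W _ (by rwa [← Category.assoc])

end ZeroCokernel

/-- The states `𝟙_ C ⟶ X` behave like subsets: the scalars are the two truth values, which are
distinct, and the inner product `a ≫ dag b` of states, the truth value of "`a` and `b` meet", is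
definite. -/
class BooleanStates (C : Type u) [Category.{v} C] [DaggerCategory C] [MonoidalCategory C]
    [HasZeroMorphisms C] : Prop where
  id_unit_ne_zero : 𝟙 (𝟙_ C) ≠ 0
  eq_zero_or_eq_id : ∀ a : 𝟙_ C ⟶ 𝟙_ C, a = 0 ∨ a = 𝟙 (𝟙_ C)
  eq_zero_of_comp_dag_self : ∀ {X : C} (a : 𝟙_ C ⟶ X), a ≫ dag a = 0 → a = 0

namespace BooleanStates

variable {C : Type u} [Category.{v} C] [DaggerCategory C] [MonoidalCategory C]
  [HasZeroMorphisms C] [BooleanStates C] {X Y : C}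

section Scalars

variable {a b : 𝟙_ C ⟶ 𝟙_ C}

theorem ne_zero_iff : a ≠ 0 ↔ a = 𝟙 (𝟙_ C) :=
  ⟨(eq_zero_or_eq_id a).resolve_left, fun h => h ▸ id_unit_ne_zero⟩

theorem scalar_ext (h : a = 𝟙 (𝟙_ C) ↔ b = 𝟙 (𝟙_ C)) : a = b := by
  simp only [← ne_zero_iff, not_iff_not] at h
  rcases eq_zero_or_eq_id a with rfl | rfl
  · exact (h.1 rfl).symm
  · exact (ne_zero_iff.1 fun hb => id_unit_ne_zero (h.2 hb)).symm

theorem dag_scalar (a : 𝟙_ C ⟶ 𝟙_ C) : dag a = a := by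
  rcases eq_zero_or_eq_id a with rfl | rfl
  · exact dag_zero
  · exact DaggerCategory.dag_id _

theorem comp_eq_id_iff : a ≫ b = 𝟙 (𝟙_ C) ↔ a = 𝟙 (𝟙_ C) ∧ b = 𝟙 (𝟙_ C) := by
  rcases eq_zero_or_eq_id a with rfl | rfl
  · simp [id_unit_ne_zero.symm]
  · simp

end Scalars

theorem comp_dag_comm (a b : 𝟙_ C ⟶ X) : a ≫ dag b = b ≫ dag a :=
  (dag_scalar _).symm.trans (by simp)

theorem comp_dag_self_eq_id_iff {a : 𝟙_ C ⟶ X} : a ≫ dag a = 𝟙 (𝟙_ C) ↔ a ≠ 0 := by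
  rw [← ne_zero_iff, not_iff_not]
  exact ⟨eq_zero_of_comp_dag_self a, by rintro rfl; exact zero_comp⟩

variable [HasDaggerBiproducts C]

/-! ### The lattice of states -/

theorem homAdd_id_id : homAdd (𝟙 (𝟙_ C)) (𝟙 (𝟙_ C)) = 𝟙 (𝟙_ C) := by
  let P := biprodOf fun _ : ULift.{v} Bool => 𝟙_ C
  have hP : P.diag ≠ 0 := fun h =>
    id_unit_ne_zero (C := C) (by rw [← P.diag_dag_inj ⟨true⟩, h, zero_comp])
  rw [homAdd_eq_homSum fun _ => 𝟙 (𝟙_ C), homSum_id, comp_dag_self_eq_id_iff]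
  exact hP

theorem homAdd_self (a : 𝟙_ C ⟶ X) : homAdd a a = a := by
  simpa only [homAdd_comp, Category.id_comp] using congrArg (· ≫ a) (homAdd_id_id (C := C))

noncomputable instance : SemilatticeSup (𝟙_ C ⟶ X) :=
  letI : Max (𝟙_ C ⟶ X) := ⟨homAdd⟩
  .mk' homAdd_comm homAdd_assoc homAdd_self

theorem sup_eq_homAdd (a b : 𝟙_ C ⟶ X) : a ⊔ b = homAdd a b := rfl

theorem le_homSum {M : Type v} (a : M → (𝟙_ C ⟶ X)) (m : M) : a m ≤ homSum a := by
  rw [homSum_eq_homAdd a m]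
  exact le_sup_left

noncomputable instance : BoundedOrder (𝟙_ C ⟶ X) where
  top := homSum fun x => x
  le_top := le_homSum fun x => x
  bot := 0
  bot_le := zero_homAdd

protected theorem bot_eq_zero : (⊥ : 𝟙_ C ⟶ X) = 0 := rfl

theorem isHomAtom_iff_isAtom {x : 𝟙_ C ⟶ X} : IsHomAtom x ↔ IsAtom x :=
  ⟨fun h => ⟨h.1, fun y hy => (h.2 y hy.le).resolve_right hy.ne⟩,
    fun h => ⟨h.1, fun _ hy => h.le_iff.1 hy⟩⟩

theorem sup_comp (a b : 𝟙_ C ⟶ X) (f : X ⟶ Y) : (a ⊔ b) ≫ f = a ≫ f ⊔ b ≫ f :=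
  homAdd_comp a b f

theorem comp_mono {a b : 𝟙_ C ⟶ X} (h : a ≤ b) (f : X ⟶ Y) : a ≫ f ≤ b ≫ f := by
  rw [← sup_eq_right] at h ⊢
  rw [← sup_comp, h]

theorem scalar_le_iff {a b : 𝟙_ C ⟶ 𝟙_ C} : a ≤ b ↔ (a = 𝟙 (𝟙_ C) → b = 𝟙 (𝟙_ C)) := by
  refine ⟨fun h ha => ne_zero_iff.1 fun hb => ?_, fun h => ?_⟩
  · exact id_unit_ne_zero (ha.symm.trans (le_bot_iff.1 (h.trans_eq hb)))
  · rcases eq_zero_or_eq_id a with rfl | rfl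
    · exact bot_le
    · exact (h rfl).ge

theorem homAdd_eq_id_iff {a b : 𝟙_ C ⟶ 𝟙_ C} :
    homAdd a b = 𝟙 (𝟙_ C) ↔ a = 𝟙 (𝟙_ C) ∨ b = 𝟙 (𝟙_ C) := by
  rw [← sup_eq_homAdd, ← ne_zero_iff, ← BooleanStates.bot_eq_zero, Ne, sup_eq_bot_iff, not_and_or]
  exact or_congr ne_zero_iff ne_zero_iff

theorem homSum_eq_id_iff {M : Type v} {a : M → (𝟙_ C ⟶ 𝟙_ C)} :
    homSum a = 𝟙 (𝟙_ C) ↔ ∃ m, a m = 𝟙 (𝟙_ C) := by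
  refine ⟨fun h => ?_, fun ⟨m, hm⟩ => scalar_le_iff.1 (le_homSum a m) hm⟩
  by_contra! h'
  have ha : a = fun _ => 0 := funext fun m => (eq_zero_or_eq_id _).resolve_right (h' m)
  rw [ha, homSum_zero] at h
  exact id_unit_ne_zero h.symm

theorem comp_dag_mono {a b c d : 𝟙_ C ⟶ X} (hac : a ≤ c) (hbd : b ≤ d) :
    a ≫ dag b ≤ c ≫ dag d :=
  calc a ≫ dag b ≤ c ≫ dag b := comp_mono hac _
    _ = b ≫ dag c := comp_dag_comm c b
    _ ≤ d ≫ dag c := comp_mono hbd _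
    _ = c ≫ dag d := comp_dag_comm d c

end BooleanStates

open BooleanStates

/-! ### Supports of states -/

/-- The states `𝟙_ C ⟶ X` jointly detect equality of morphisms out of `X`. -/
class WellPointed (C : Type u) [Category.{v} C] [MonoidalCategory C] : Prop where
  isSeparator_unit : IsSeparator (𝟙_ C)

namespace WellPointed

variable {C : Type u} [Category.{v} C] [DaggerCategory C] [MonoidalCategory C] [WellPointed C]
  {X Y : C}

omit [DaggerCategory C] in
theorem hom_ext_state {r s : X ⟶ Y} (h : ∀ x : 𝟙_ C ⟶ X, x ≫ r = x ≫ s) : r = s :=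
  (isSeparator_def _).1 isSeparator_unit r s h

theorem hom_ext_scalar {r s : X ⟶ Y}
    (h : ∀ (x : 𝟙_ C ⟶ X) (y : 𝟙_ C ⟶ Y), x ≫ r ≫ dag y = x ≫ s ≫ dag y) : r = s :=
  hom_ext_state fun x => dag_injective <| hom_ext_state fun y => dag_injective <| by
    simpa using h x y

theorem hasZeroCokernel_top [HasZeroMorphisms C] [BooleanStates C] [HasDaggerBiproducts C]
    (X : C) : HasZeroCokernel (⊤ : 𝟙_ C ⟶ X) :=
  hasZeroCokernel_iff.2 fun Z q hq => hom_ext_state fun x => by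
    rw [comp_zero]
    exact le_bot_iff.1 ((comp_mono le_top q).trans_eq hq)

end WellPointed

/-- Every state `a` of `X` has a support: a dagger summand `A` of `X`, with complementary summand
`B`, whose largest state is mapped to `a` by the inclusion `j` of `A`. -/
class HasSupports (C : Type u) [Category.{v} C] [DaggerCategory C] [MonoidalCategory C]
    [HasZeroMorphisms C] [BooleanStates C] [HasDaggerBiproducts C] : Prop where
  exists_support : ∀ {X : C} (a : 𝟙_ C ⟶ X), ∃ (A B : C) (j : A ⟶ X) (k : B ⟶ X),
    ⊤ ≫ j = a ∧ j ≫ dag j = 𝟙 A ∧ j ≫ dag k = 0 ∧ homAdd (dag j ≫ j) (dag k ≫ k) = 𝟙 X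

namespace HasSupports

variable {C : Type u} [Category.{v} C] [DaggerCategory C] [MonoidalCategory C]
  [HasZeroMorphisms C] [BooleanStates C] [HasDaggerBiproducts C] [HasSupports C] {X : C}
  {a b x : 𝟙_ C ⟶ X}

theorem exists_sup_eq (a b : 𝟙_ C ⟶ X) :
    ∃ p q : 𝟙_ C ⟶ X, p ⊔ q = b ∧ p ≤ a ∧ a ≫ dag q = 0 := by
  obtain ⟨A, B, j, k, rfl, -, hjk, h⟩ := exists_support a
  refine ⟨(b ≫ dag j) ≫ j, (b ≫ dag k) ≫ k, ?_, comp_mono le_top j, ?_⟩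
  · rw [Category.assoc, Category.assoc, sup_eq_homAdd, ← comp_homAdd, h, Category.comp_id]
  · rw [DaggerCategory.dag_comp, Category.assoc, reassoc_of% hjk, zero_comp, comp_zero]

theorem comp_dag_eq_zero_iff_disjoint : a ≫ dag b = 0 ↔ Disjoint a b := by
  refine ⟨fun h c hca hcb => ?_, fun h => ?_⟩
  · exact (eq_zero_of_comp_dag_self c (le_bot_iff.1 ((comp_dag_mono hca hcb).trans_eq h))).le
  · obtain ⟨p, q, rfl, hp, hq⟩ := exists_sup_eq a b
    rwa [le_bot_iff.1 (h hp le_sup_left), bot_sup_eq]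

theorem comp_dag_eq_id_iff_not_disjoint : a ≫ dag b = 𝟙 (𝟙_ C) ↔ ¬ Disjoint a b := by
  rw [← ne_zero_iff, Ne, comp_dag_eq_zero_iff_disjoint]

theorem exists_isCompl (a : 𝟙_ C ⟶ X) : ∃ c, IsCompl a c := by
  obtain ⟨p, q, h, hp, hq⟩ := exists_sup_eq a ⊤
  exact ⟨q, comp_dag_eq_zero_iff_disjoint.1 hq,
    codisjoint_iff.2 (top_unique (h.ge.trans (sup_le_sup_right hp q)))⟩

theorem exists_disjoint_of_lt (h : a < b) : ∃ q ≤ b, q ≠ 0 ∧ Disjoint a q := by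
  obtain ⟨p, q, rfl, hp, hq⟩ := exists_sup_eq a b
  refine ⟨q, le_sup_right, ?_, comp_dag_eq_zero_iff_disjoint.1 hq⟩
  rintro rfl
  exact h.not_ge (sup_le hp bot_le)

theorem exists_le_of_comp_dag_eq_id (h : a ≫ dag b = 𝟙 (𝟙_ C)) : ∃ c ≠ 0, c ≤ a ∧ c ≤ b := by
  rw [comp_dag_eq_id_iff_not_disjoint, Disjoint] at h
  push Not at h
  obtain ⟨c, hca, hcb, hc⟩ := h
  exact ⟨c, fun h => hc h.le, hca, hcb⟩

theorem le_of_isAtom_of_comp_dag (hx : IsAtom x) (h : x ≫ dag a = 𝟙 (𝟙_ C)) : x ≤ a := by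
  obtain ⟨c, hc, hcx, hca⟩ := exists_le_of_comp_dag_eq_id h
  rwa [← (hx.le_iff_eq hc).1 hcx]

theorem comp_dag_eq_id_iff_eq {y : 𝟙_ C ⟶ X} (hx : IsAtom x) (hy : IsAtom y) :
    x ≫ dag y = 𝟙 (𝟙_ C) ↔ x = y :=
  ⟨fun h => (hy.le_iff_eq hx.1).1 (le_of_isAtom_of_comp_dag hx h),
    fun h => h ▸ comp_dag_self_eq_id_iff.2 hx.1⟩

end HasSupports

/-! ### Atomicity -/

section Atomicity

variable {C : Type u} [Category.{v} C] [DaggerCategory C] [MonoidalCategory C]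

/-- The effect on the internal hom `[A, B]` that reads off the entry of a matrix at `(x, y)`; see
`comp_matrixEffect`. -/
def matrixEffect {A B : C} [Closed A] (x : 𝟙_ C ⟶ A) (y : 𝟙_ C ⟶ B) : (ihom A).obj B ⟶ 𝟙_ C :=
  (λ_ _).inv ≫ x ▷ _ ≫ (ihom.ev A).app B ≫ dag y

theorem comp_matrixEffect {A B : C} [Closed A] (m : 𝟙_ C ⟶ (ihom A).obj B) (x : 𝟙_ C ⟶ A)
    (y : 𝟙_ C ⟶ B) : m ≫ matrixEffect x y = x ≫ MonoidalClosed.uncurry' m ≫ dag y := by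
  rw [matrixEffect, leftUnitor_inv_naturality_assoc, whisker_exchange_assoc, unitors_inv_equal,
    MonoidalClosed.uncurry', MonoidalClosed.uncurry_eq]
  simp only [Category.assoc, rightUnitor_inv_naturality_assoc]

variable [HasZeroMorphisms C] [BooleanStates C] [HasDaggerBiproducts C] {A B X : C}

theorem top_comp_matrixEffect [Closed A] {x : 𝟙_ C ⟶ A} {y : 𝟙_ C ⟶ B} (hx : x ≠ 0) (hy : y ≠ 0) :
    ⊤ ≫ matrixEffect x y = 𝟙 (𝟙_ C) := by
  refine scalar_le_iff.1 (comp_mono (le_top (a := MonoidalClosed.curry' (dag x ≫ y))) _) ?_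
  rw [comp_matrixEffect, MonoidalClosed.uncurry'_curry', Category.assoc,
    comp_dag_self_eq_id_iff.2 hy, Category.comp_id, comp_dag_self_eq_id_iff.2 hx]

theorem le_iff_comp_matrixEffect_le [WellPointed C] [Closed A] {m n : 𝟙_ C ⟶ (ihom A).obj B} :
    m ≤ n ↔ ∀ x y, m ≫ matrixEffect x y ≤ n ≫ matrixEffect x y := by
  refine ⟨fun h x y => comp_mono h _, fun h => sup_eq_right.1 ?_⟩
  refine MonoidalClosed.uncurry'_injective (WellPointed.hom_ext_scalar fun x y => ?_)
  rw [← comp_matrixEffect, ← comp_matrixEffect, sup_comp, sup_eq_right.2 (h x y)]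

variable [HasSupports C]

theorem exists_disjoint_of_not_isAtom {z : 𝟙_ C ⟶ X} (hz : z ≠ 0) (h : ¬ IsAtom z) :
    ∃ p ≤ z, ∃ q ≤ z, p ≠ 0 ∧ q ≠ 0 ∧ Disjoint p q := by
  obtain ⟨p, hp, hp0⟩ : ∃ p < z, p ≠ 0 := by
    by_contra! h'
    exact h ⟨hz, h'⟩
  obtain ⟨q, hq, hq0, hpq⟩ := HasSupports.exists_disjoint_of_lt hp
  exact ⟨p, hp.le, q, hq, hp0, hq0, hpq⟩

/-- The name of `r` is the complement of the name of the identity in the lattice of states of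
`[A, A]`. -/
theorem exists_compl_id [WellPointed C] (A : C) [Closed A] : ∃ r : A ⟶ A,
    (∀ x y : 𝟙_ C ⟶ A, x ≠ 0 → y ≠ 0 → Disjoint x y → x ≫ r ≫ dag y = 𝟙 (𝟙_ C)) ∧
    ((∀ x y : 𝟙_ C ⟶ A, x ≫ dag y = 𝟙 (𝟙_ C) → x ≫ r ≫ dag y = 𝟙 (𝟙_ C)) → 𝟙 A = 0) := by
  let n : 𝟙_ C ⟶ (ihom A).obj A := MonoidalClosed.curry' (𝟙 A)
  have hn (x y : 𝟙_ C ⟶ A) : n ≫ matrixEffect x y = x ≫ dag y := by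
    rw [comp_matrixEffect, MonoidalClosed.uncurry'_curry', Category.id_comp]
  obtain ⟨c, hc⟩ := HasSupports.exists_isCompl n
  refine ⟨MonoidalClosed.uncurry' c, fun x y hx hy hxy => ?_, fun h => ?_⟩
  · rw [← top_comp_matrixEffect hx hy, ← codisjoint_iff.1 hc.codisjoint, sup_comp, hn,
      HasSupports.comp_dag_eq_zero_iff_disjoint.2 hxy, ← BooleanStates.bot_eq_zero, bot_sup_eq,
      comp_matrixEffect]
  · have hnc : n ≤ c := le_iff_comp_matrixEffect_le.2 fun x y => scalar_le_iff.2 fun hxy => by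
      rw [comp_matrixEffect]
      exact h x y (by rwa [← hn])
    have hn0 : n = 0 := hc.disjoint.eq_bot_of_le hnc
    refine WellPointed.hom_ext_scalar fun x y => ?_
    rw [Category.id_comp, ← hn, hn0, zero_comp, zero_comp, comp_zero]

theorem exists_isAtom [WellPointed C] [Closed A] (hA : 𝟙 A ≠ 0) :
    ∃ x : 𝟙_ C ⟶ A, IsAtom x := by
  -- Without atoms, states that meet contain disjoint states, so the complement of the identity
  -- dominates the identity.
  by_contra! hatom
  obtain ⟨r, hr, hr0⟩ := exists_compl_id A
  refine hA (hr0 fun x y hxy => ?_)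
  obtain ⟨z, hz, hzx, hzy⟩ := HasSupports.exists_le_of_comp_dag_eq_id hxy
  obtain ⟨p, hp, q, hq, hp0, hq0, hpq⟩ := exists_disjoint_of_not_isAtom hz (hatom z)
  have hle := comp_dag_mono (comp_mono (hp.trans hzx) r) (hq.trans hzy)
  rw [Category.assoc, Category.assoc] at hle
  exact scalar_le_iff.1 hle (hr p q hp0 hq0 hpq)

omit [HasSupports C] in
theorem isAtom_comp {j : A ⟶ X} (hj : j ≫ dag j = 𝟙 A) {x : 𝟙_ C ⟶ A} (hx : IsAtom x)
    (h : ∀ y ≤ x ≫ j, y ≫ dag j ≫ j = y) : IsAtom (x ≫ j) := by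
  have hxj : (x ≫ j) ≫ dag j = x := by rw [Category.assoc, hj, Category.comp_id]
  refine ⟨fun h0 => hx.1 ?_, fun y hy => ?_⟩
  · rw [← hxj, h0]
    exact zero_comp
  · have hle : y ≫ dag j ≤ x := hxj ▸ comp_mono hy.le (dag j)
    rw [← h y hy.le, ← Category.assoc]
    rcases hx.le_iff.1 hle with h0 | h0
    · rw [h0]
      exact zero_comp
    · exact (hy.ne (by rw [← h y hy.le, ← Category.assoc, h0])).elim

theorem exists_isAtom_le [WellPointed C] [MonoidalClosed C] {a : 𝟙_ C ⟶ X} (ha : a ≠ 0) :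
    ∃ x ≤ a, IsAtom x := by
  obtain ⟨A, B, j, k, rfl, hj, hjk, h⟩ := HasSupports.exists_support a
  have hA : 𝟙 A ≠ 0 := fun h0 => ha (by rw [← Category.id_comp j, h0, zero_comp, comp_zero])
  obtain ⟨x, hx⟩ := exists_isAtom hA
  refine ⟨x ≫ j, comp_mono le_top j, isAtom_comp hj hx fun y hy => ?_⟩
  have hyk : y ≫ dag k = 0 := le_bot_iff.1 <| (comp_mono hy (dag k)).trans_eq <| by
    rw [Category.assoc, hjk, comp_zero, BooleanStates.bot_eq_zero]
  rw [← Category.comp_id y, ← h, comp_homAdd, reassoc_of% hyk, zero_comp, homAdd_zero]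
  simp only [Category.assoc, reassoc_of% hj]

theorem exists_isAtom_le_of_comp_dag_eq_id [WellPointed C] [MonoidalClosed C] {a b : 𝟙_ C ⟶ X}
    (h : a ≫ dag b = 𝟙 (𝟙_ C)) : ∃ x ≤ a, IsAtom x ∧ x ≫ dag b = 𝟙 (𝟙_ C) := by
  obtain ⟨c, hc, hca, hcb⟩ := HasSupports.exists_le_of_comp_dag_eq_id h
  obtain ⟨x, hxc, hx⟩ := exists_isAtom_le hc
  refine ⟨x, hxc.trans hca, hx, ?_⟩
  exact scalar_le_iff.1 (comp_dag_mono le_rfl (hxc.trans hcb)) (comp_dag_self_eq_id_iff.2 hx.1)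

end Atomicity

/-! ### Bases of states -/

/-- A family of states of `X` is a basis when it is orthonormal and determines the morphisms out
of `X`. -/
structure IsStateBasis {C : Type u} [Category.{v} C] [DaggerCategory C] [MonoidalCategory C]
    {ι : Type*} {X : C} (e : ι → (𝟙_ C ⟶ X)) : Prop where
  comp_dag_eq_id_iff : ∀ i j, e i ≫ dag (e j) = 𝟙 (𝟙_ C) ↔ i = j
  hom_ext : ∀ {Y : C} {r s : X ⟶ Y}, (∀ i, e i ≫ r = e i ≫ s) → r = s

namespace IsStateBasis

variable {C : Type u} [Category.{v} C] [DaggerCategory C] [MonoidalCategory C] {X Y : C}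
  {ι κ : Type*} {e : ι → (𝟙_ C ⟶ X)} {d : κ → (𝟙_ C ⟶ Y)}

theorem injective (he : IsStateBasis e) : Function.Injective e := fun i j hij => by
  rw [← he.comp_dag_eq_id_iff, hij, he.comp_dag_eq_id_iff]

variable [HasZeroMorphisms C] [BooleanStates C]

theorem hom_ext_scalar (he : IsStateBasis e) (hd : IsStateBasis d) {r s : X ⟶ Y}
    (h : ∀ i j, e i ≫ r ≫ dag (d j) = 𝟙 (𝟙_ C) ↔ e i ≫ s ≫ dag (d j) = 𝟙 (𝟙_ C)) : r = s :=
  he.hom_ext fun i => dag_injective <| hd.hom_ext fun j => dag_injective <| by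
    simpa using scalar_ext (h i j)

theorem state_ext (he : IsStateBasis e) {a b : 𝟙_ C ⟶ X}
    (h : ∀ i, a ≫ dag (e i) = 𝟙 (𝟙_ C) ↔ b ≫ dag (e i) = 𝟙 (𝟙_ C)) : a = b :=
  dag_injective <| he.hom_ext fun i => dag_injective <| by simpa using scalar_ext (h i)

theorem exists_comp_dag_eq_id (he : IsStateBasis e) {a : 𝟙_ C ⟶ X} (ha : a ≠ 0) :
    ∃ i, a ≫ dag (e i) = 𝟙 (𝟙_ C) := by
  by_contra! h
  refine ha (he.state_ext fun i => iff_of_false (h i) ?_)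
  rw [zero_comp]
  exact id_unit_ne_zero.symm

variable [HasDaggerBiproducts C]

theorem le_of_comp_dag_eq_id (he : IsStateBasis e) {a : 𝟙_ C ⟶ X} {i : ι}
    (h : a ≫ dag (e i) = 𝟙 (𝟙_ C)) : e i ≤ a := by
  rw [← sup_eq_right]
  refine he.state_ext fun j => ?_
  rw [sup_comp, sup_eq_homAdd, homAdd_eq_id_iff, he.comp_dag_eq_id_iff, or_iff_right_iff_imp]
  rintro rfl
  exact h

theorem isHomAtom (he : IsStateBasis e) (i : ι) : IsHomAtom (e i) := by
  refine isHomAtom_iff_isAtom.2 ⟨?_, fun a ha => ?_⟩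
  · exact comp_dag_self_eq_id_iff.1 ((he.comp_dag_eq_id_iff i i).2 rfl)
  · by_contra ha0
    obtain ⟨j, hj⟩ := he.exists_comp_dag_eq_id ha0
    have hij : i = j :=
      (he.comp_dag_eq_id_iff i j).1 (scalar_le_iff.1 (comp_mono ha.le _) hj)
    exact ha.not_ge (he.le_of_comp_dag_eq_id (hij ▸ hj))

theorem exists_eq_of_isHomAtom (he : IsStateBasis e) {a : 𝟙_ C ⟶ X} (ha : IsHomAtom a) :
    ∃ i, e i = a := by
  obtain ⟨i, hi⟩ := he.exists_comp_dag_eq_id ha.1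
  exact ⟨i, ((isHomAtom_iff_isAtom.1 ha).le_iff_eq (he.isHomAtom i).1).1
    (he.le_of_comp_dag_eq_id hi)⟩

theorem homSum_dag_comp {ι : Type v} {e : ι → (𝟙_ C ⟶ X)} (he : IsStateBasis e) :
    homSum (fun i => dag (e i) ≫ e i) = 𝟙 X := by
  refine he.hom_ext fun j => ?_
  simp only [comp_homSum, ← Category.assoc, Category.comp_id]
  rw [homSum_eq_single j fun i hi => ?_, (he.comp_dag_eq_id_iff j j).2 rfl, Category.id_comp]
  rw [(eq_zero_or_eq_id _).resolve_right fun h => hi ((he.comp_dag_eq_id_iff j i).1 h).symm,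
    zero_comp]

theorem comp_eq_id_iff {ι : Type v} {e : ι → (𝟙_ C ⟶ X)} (he : IsStateBasis e)
    (f : 𝟙_ C ⟶ X) (g : X ⟶ 𝟙_ C) :
    f ≫ g = 𝟙 (𝟙_ C) ↔ ∃ i, f ≫ dag (e i) = 𝟙 (𝟙_ C) ∧ e i ≫ g = 𝟙 (𝟙_ C) := by
  have h : f ≫ g = homSum fun i => (f ≫ dag (e i)) ≫ e i ≫ g := by
    conv_lhs => rw [← Category.id_comp g, ← he.homSum_dag_comp, homSum_comp, comp_homSum]
    simp only [Category.assoc]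
  simp only [h, homSum_eq_id_iff, BooleanStates.comp_eq_id_iff]

end IsStateBasis

/-- The atoms of each object form a basis. -/
class HasAtomBasis (C : Type u) [Category.{v} C] [DaggerCategory C] [MonoidalCategory C]
    [HasZeroMorphisms C] [HasDaggerBiproducts C] : Prop where
  isStateBasis_atoms : ∀ X : C, IsStateBasis fun x : {x : 𝟙_ C ⟶ X // IsHomAtom x} => x.1

instance (C : Type u) [Category.{v} C] [DaggerCategory C] [MonoidalCategory C]
    [HasZeroMorphisms C] [HasDaggerBiproducts C] [BooleanStates C] [WellPointed C]
    [HasSupports C] [MonoidalClosed C] : HasAtomBasis C where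
  isStateBasis_atoms X := by
    refine ⟨fun x y => ?_, fun {Y r s} h => ?_⟩
    · rw [HasSupports.comp_dag_eq_id_iff_eq (isHomAtom_iff_isAtom.1 x.2)
        (isHomAtom_iff_isAtom.1 y.2), Subtype.ext_iff]
    have hle {f g : X ⟶ Y} (hfg : ∀ x : {x : 𝟙_ C ⟶ X // IsHomAtom x}, x.1 ≫ f = x.1 ≫ g)
        {a : 𝟙_ C ⟶ X} {b : 𝟙_ C ⟶ Y} (ha : a ≫ f ≫ dag b = 𝟙 (𝟙_ C)) :
        a ≫ g ≫ dag b = 𝟙 (𝟙_ C) := by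
      obtain ⟨x, hxa, hx, hxb⟩ :=
        exists_isAtom_le_of_comp_dag_eq_id (a := a) (b := b ≫ dag f) (by simpa using ha)
      simp only [DaggerCategory.dag_comp, DaggerCategory.dag_dag] at hxb
      rw [reassoc_of% hfg ⟨x, isHomAtom_iff_isAtom.2 hx⟩] at hxb
      exact scalar_le_iff.1 (comp_mono hxa _) hxb
    exact WellPointed.hom_ext_scalar fun a b => scalar_ext ⟨hle h, hle fun x => (h x).symm⟩

section FromAxioms

variable {C : Type u} [Category.{v} C] [DaggerCategory C] [MonoidalCategory C]
  [HasZeroMorphisms C] [HasDaggerBiproducts C]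

theorem UnitMorphismsFactor.exists_support (hfac : UnitMorphismsFactor C) {X : C}
    (a : 𝟙_ C ⟶ X) : ∃ (A B : C) (t : 𝟙_ C ⟶ A) (j : A ⟶ X) (k : B ⟶ X),
      HasZeroCokernel t ∧ t ≫ j = a ∧ j ≫ dag j = 𝟙 A ∧ j ≫ dag k = 0 ∧
        homAdd (dag j ≫ j) (dag k ≫ k) = 𝟙 X := by
  obtain ⟨A, B, P, i, t, hi, ht, rfl⟩ := hfac X a
  have hdag {U V : C} (f : U ⟶ P.pt) (g : V ⟶ P.pt) : (f ≫ i) ≫ dag (g ≫ i) = f ≫ dag g := by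
    rw [DaggerCategory.dag_comp, Category.assoc, reassoc_of% hi.1]
  refine ⟨A, B, t, P.inc₁ ≫ i, P.inc₂ ≫ i, ht, rfl, ?_, ?_, ?_⟩
  · rw [hdag, P.inc₁_comp_dag_inc₁]
  · rw [hdag, P.inc₁_comp_dag_inc₂]
  · simp only [DaggerCategory.dag_comp, Category.assoc, ← comp_homAdd]
    simp only [← Category.assoc _ _ i, ← homAdd_comp, P.homAdd_id, Category.id_comp, hi.2]

theorem booleanStates_of_unitMorphismsFactor [Simple (𝟙_ C)]
    (htop : ∃! t : 𝟙_ C ⟶ 𝟙_ C, HasZeroCokernel t) (hfac : UnitMorphismsFactor C) :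
    BooleanStates C where
  id_unit_ne_zero := id_nonzero _
  eq_zero_or_eq_id a := by
    obtain ⟨A, B, t, j, k, ht, rfl, hj, -⟩ := hfac.exists_support a
    by_cases hj0 : j = 0
    · exact Or.inl (by rw [hj0, comp_zero])
    · have : Mono j := (SplitMono.mk _ hj).mono
      have : IsIso j := isIso_of_mono_of_nonzero hj0
      exact Or.inr (htop.unique (ht.comp_iso j) (hasZeroCokernel_id _))
  eq_zero_of_comp_dag_self a h := by
    obtain ⟨A, B, t, j, k, ht, rfl, hj, -⟩ := hfac.exists_support a
    rw [DaggerCategory.dag_comp, Category.assoc, reassoc_of% hj] at h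
    rw [dag_eq_zero_iff.1 (hasZeroCokernel_iff.1 ht _ _ h), zero_comp]

theorem hasSupports_of_unitMorphismsFactor [BooleanStates C] [WellPointed C]
    (htop : ∀ X : C, ∃! t : 𝟙_ C ⟶ X, HasZeroCokernel t) (hfac : UnitMorphismsFactor C) :
    HasSupports C where
  exists_support {X} a := by
    obtain ⟨A, B, t, j, k, ht, rfl, h⟩ := hfac.exists_support a
    rw [(htop A).unique ht (WellPointed.hasZeroCokernel_top A)]
    exact ⟨A, B, j, k, rfl, h⟩

theorem hasAtomBasis_of_unitMorphismsFactor [MonoidalClosed C] [BooleanStates C]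
    (hsep : IsSeparator (𝟙_ C)) (htop : ∀ X : C, ∃! t : 𝟙_ C ⟶ X, HasZeroCokernel t)
    (hfac : UnitMorphismsFactor C) : HasAtomBasis C :=
  have : WellPointed C := ⟨hsep⟩
  have : HasSupports C := hasSupports_of_unitMorphismsFactor htop hfac
  inferInstance

end FromAxioms

/-! ### Graphs of functions -/

/-- The isomorphism underlying a dagger isomorphism. -/
def IsDaggerIso.iso {C : Type u} [Category.{v} C] [DaggerCategory C] {X Y : C} {f : X ⟶ Y}
    (h : IsDaggerIso f) : X ≅ Y where
  hom := f
  inv := dag f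
  hom_inv_id := h.1
  inv_hom_id := h.2

theorem IsDaggerIso.dag {C : Type u} [Category.{v} C] [DaggerCategory C] {X Y : C} {f : X ⟶ Y}
    (h : IsDaggerIso f) : IsDaggerIso (dag f) := by
  rwa [IsDaggerIso, DaggerCategory.dag_dag, and_comm]

namespace RelSets

variable {X Y Z W : RelCat.{v}}

/-- The graph of a function, as a morphism of `RelCat`. -/
def graph (φ : carrier X → carrier Y) : X ⟶ Y :=
  mk fun x y => φ x = y

@[simp] theorem rel_graph (φ : carrier X → carrier Y) (x : carrier X) (y : carrier Y) :
    rel (graph φ) x y ↔ φ x = y := Iff.rfl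

@[simp] theorem rel_graph_comp (φ : carrier X → carrier Y) (R : Y ⟶ Z) (x : carrier X)
    (z : carrier Z) : rel (graph φ ≫ R) x z ↔ rel R (φ x) z := by
  simp only [rel_comp, rel_graph, exists_eq_left']

@[simp] theorem rel_comp_dag_graph (R : X ⟶ Y) (φ : carrier Z → carrier Y) (x : carrier X)
    (z : carrier Z) : rel (R ≫ dag (graph φ)) x z ↔ rel R x (φ z) := by
  simp only [rel_comp, rel_dag, rel_graph, exists_eq_right']

theorem graph_comp (φ : carrier X → carrier Y) (ψ : carrier Y → carrier Z) :
    graph φ ≫ graph ψ = graph (ψ ∘ φ) :=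
  hom_ext fun x z => by simp

theorem graph_whiskerRight (φ : carrier X → carrier Y) (Z : RelCat.{v}) :
    graph φ ▷ Z = graph (X := X ⊗ Z) (Y := Y ⊗ Z) (Prod.map φ id) :=
  hom_ext fun p q => (Prod.ext_iff (x := (φ p.1, p.2)) (y := q)).symm

theorem whiskerLeft_graph (X : RelCat.{v}) (φ : carrier Y → carrier Z) :
    X ◁ graph φ = graph (X := X ⊗ Y) (Y := X ⊗ Z) (Prod.map id φ) :=
  hom_ext fun p q => (Prod.ext_iff (x := (p.1, φ p.2)) (y := q)).symm

theorem isDaggerIso_graph {φ : carrier X → carrier Y} (hφ : Function.Bijective φ) :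
    IsDaggerIso (graph φ) := by
  refine ⟨hom_ext fun x y => ?_, hom_ext fun x y => ?_⟩
  · rw [rel_comp_dag_graph, rel_graph, hφ.1.eq_iff, rel_id]
  · rw [rel_comp, rel_id]
    constructor
    · rintro ⟨z, hx, hy⟩
      exact (Eq.symm hx).trans hy
    · rintro rfl
      obtain ⟨z, hz⟩ := hφ.2 x
      exact ⟨z, hz, hz⟩

end RelSets

/-! ### The functor of atoms -/

open RelSets

section AtomFunctor

variable {C : Type u} [Category.{v} C] [DaggerCategory C] [MonoidalCategory C]
  [HasZeroMorphisms C] [HasDaggerBiproducts C] {X Y Z : C}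

theorem rel_atomMap (r : X ⟶ Y) (x : carrier (atomSet X)) (y : carrier (atomSet Y)) :
    rel (atomMap r) x y ↔ x.1 ≫ r ≫ dag y.1 = 𝟙 (𝟙_ C) := Iff.rfl

theorem isStateBasis_val [HasAtomBasis C] (X : C) :
    IsStateBasis fun x : carrier (atomSet X) => x.1 :=
  HasAtomBasis.isStateBasis_atoms X

variable [BooleanStates C]

theorem atomMap_dag (f : X ⟶ Y) : atomMap (dag f) = dag (atomMap f) := by
  refine hom_ext fun y x => ?_
  rw [rel_dag, rel_atomMap, rel_atomMap, ← Category.assoc x.1, comp_dag_comm,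
    DaggerCategory.dag_comp]

/-- The states of a basis, as atoms. -/
def IsStateBasis.toAtom {ι : Type*} {e : ι → (𝟙_ C ⟶ X)} (he : IsStateBasis e) (i : ι) :
    carrier (atomSet X) :=
  ⟨e i, he.isHomAtom i⟩

theorem IsStateBasis.bijective_toAtom {ι : Type*} {e : ι → (𝟙_ C ⟶ X)} (he : IsStateBasis e) :
    Function.Bijective he.toAtom :=
  ⟨fun _ _ h => he.injective (congrArg Subtype.val h), fun x =>
    (he.exists_eq_of_isHomAtom x.2).imp fun _ => Subtype.ext⟩

omit [HasDaggerBiproducts C] in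
theorem isStateBasis_inj {M : Type v} (P : DaggerBiproduct fun _ : M => 𝟙_ C) :
    IsStateBasis P.inj where
  comp_dag_eq_id_iff m n := by
    refine ⟨fun h => ?_, fun h => h ▸ P.inj_dag_self m⟩
    by_contra hmn
    exact id_unit_ne_zero (h.symm.trans (P.inj_dag_of_ne m n hmn))
  hom_ext := P.hom_ext_inj

theorem exists_isDaggerIso_atomSet (S : RelCat.{v}) :
    ∃ (X : C) (i : atomSet X ⟶ S), IsDaggerIso i :=
  let P := biprodOf fun _ : carrier S => 𝟙_ C
  ⟨P.pt, _, (isDaggerIso_graph (isStateBasis_inj P).bijective_toAtom).dag⟩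

variable [HasAtomBasis C]

omit [BooleanStates C] in
theorem atomMap_id (X : C) : atomMap (𝟙 X) = 𝟙 (atomSet X) := by
  refine hom_ext fun x y => ?_
  rw [rel_atomMap, Category.id_comp]
  exact (isStateBasis_val X).comp_dag_eq_id_iff x y

theorem atomMap_comp (f : X ⟶ Y) (g : Y ⟶ Z) : atomMap (f ≫ g) = atomMap f ≫ atomMap g := by
  refine hom_ext fun x z => ?_
  rw [rel_atomMap, Category.assoc, ← Category.assoc, (isStateBasis_val Y).comp_eq_id_iff]
  simp only [rel_comp, rel_atomMap, Category.assoc]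

theorem atomMap_injective : Function.Injective (atomMap : (X ⟶ Y) → _) := fun f g h =>
  (isStateBasis_val X).hom_ext_scalar (isStateBasis_val Y) fun x y => by
    rw [← rel_atomMap, ← rel_atomMap, h]

theorem atomMap_surjective : Function.Surjective (atomMap : (X ⟶ Y) → _) := fun R => by
  refine ⟨homSum fun p : {p : carrier (atomSet X) × carrier (atomSet Y) // rel R p.1 p.2} =>
    dag p.1.1.1 ≫ p.1.2.1, hom_ext fun x y => ?_⟩
  rw [rel_atomMap, homSum_comp, comp_homSum, homSum_eq_id_iff]
  simp only [Category.assoc]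
  simp only [← Category.assoc x.1, BooleanStates.comp_eq_id_iff,
    (isStateBasis_val X).comp_dag_eq_id_iff, (isStateBasis_val Y).comp_dag_eq_id_iff]
  exact ⟨fun ⟨⟨_, h⟩, hx, hy⟩ => hx ▸ hy ▸ h, fun h => ⟨⟨(x, y), h⟩, rfl, rfl⟩⟩

theorem isDaggerEquivalence_atomFunctor (hid : ∀ X : C, atomMap (𝟙 X) = 𝟙 (atomSet X))
    (hcomp : ∀ (X Y Z : C) (f : X ⟶ Y) (g : Y ⟶ Z), atomMap (f ≫ g) = atomMap f ≫ atomMap g) :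
    IsDaggerEquivalence (atomFunctor C hid hcomp) where
  map_dag := atomMap_dag
  full := ⟨fun R => atomMap_surjective R⟩
  faithful := ⟨fun h => atomMap_injective h⟩
  surj := exists_isDaggerIso_atomSet

omit [BooleanStates C] in
theorem graph_comp_atomMap {S : RelCat.{v}} {φ : carrier S → carrier (atomSet X)} {f : X ⟶ Y}
    {ψ : carrier S → carrier (atomSet Y)} (h : ∀ s, (φ s).1 ≫ f = (ψ s).1) :
    graph φ ≫ atomMap f = graph ψ := by
  refine hom_ext fun s y => ?_
  rw [rel_graph_comp, rel_atomMap, ← Category.assoc, h, rel_graph]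
  exact (isStateBasis_val Y).comp_dag_eq_id_iff (ψ s) y

end AtomFunctor

/-! ### The monoidal structure -/

section TensorStates

variable {C : Type u} [Category.{v} C] [MonoidalCategory C] {X Y Z X' Y' : C}

/-- The tensor product of two states, as a state. -/
def tensorState (x : 𝟙_ C ⟶ X) (y : 𝟙_ C ⟶ Y) : 𝟙_ C ⟶ X ⊗ Y :=
  (λ_ (𝟙_ C)).inv ≫ (x ⊗ₘ y)

theorem tensorState_comp (x : 𝟙_ C ⟶ X) (y : 𝟙_ C ⟶ Y) (f : X ⟶ X') (g : Y ⟶ Y') :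
    tensorState x y ≫ (f ⊗ₘ g) = tensorState (x ≫ f) (y ≫ g) := by
  simp [tensorState]

theorem tensorState_eq_comp_whiskerLeft (x : 𝟙_ C ⟶ X) (y : 𝟙_ C ⟶ Y) :
    tensorState x y = x ≫ (ρ_ X).inv ≫ X ◁ y := by
  rw [tensorState, MonoidalCategory.tensorHom_def, rightUnitor_inv_naturality_assoc,
    unitors_inv_equal]

theorem tensorState_leftUnitor (x : 𝟙_ C ⟶ X) :
    tensorState (𝟙 (𝟙_ C)) x ≫ (λ_ X).hom = x := by
  simp [tensorState]

theorem tensorState_rightUnitor (x : 𝟙_ C ⟶ X) :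
    tensorState x (𝟙 (𝟙_ C)) ≫ (ρ_ X).hom = x := by
  simp [tensorState_eq_comp_whiskerLeft]

theorem tensorState_scalar (a b : 𝟙_ C ⟶ 𝟙_ C) :
    tensorState a b ≫ (λ_ (𝟙_ C)).hom = a ≫ b := by
  rw [tensorState_eq_comp_whiskerLeft, Category.assoc, Category.assoc, leftUnitor_naturality,
    unitors_equal, Iso.inv_hom_id_assoc]

theorem tensorState_associator (x : 𝟙_ C ⟶ X) (y : 𝟙_ C ⟶ Y) (z : 𝟙_ C ⟶ Z) :
    tensorState (tensorState x y) z ≫ (α_ X Y Z).hom = tensorState x (tensorState y z) := by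
  simp only [tensorState_eq_comp_whiskerLeft, Category.assoc, MonoidalCategory.whiskerLeft_comp]
  monoidal

theorem tensorState_braiding [BraidedCategory C] (x : 𝟙_ C ⟶ X) (y : 𝟙_ C ⟶ Y) :
    tensorState x y ≫ (β_ X Y).hom = tensorState y x := by
  simp [tensorState, BraidedCategory.braiding_naturality, unitors_inv_equal]

theorem tensorState_hom_ext [Closed X] {r s : X ⊗ Y ⟶ Z} {ι κ : Type*} {e : ι → (𝟙_ C ⟶ X)}
    {d : κ → (𝟙_ C ⟶ Y)} (he : ∀ {W : C} {f g : X ⟶ W}, (∀ i, e i ≫ f = e i ≫ g) → f = g)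
    (hd : ∀ {W : C} {f g : Y ⟶ W}, (∀ j, d j ≫ f = d j ≫ g) → f = g)
    (h : ∀ i j, tensorState (e i) (d j) ≫ r = tensorState (e i) (d j) ≫ s) : r = s := by
  refine MonoidalClosed.curry_injective (hd fun j => ?_)
  rw [← MonoidalClosed.curry_natural_left, ← MonoidalClosed.curry_natural_left]
  refine congrArg _ ((cancel_epi (ρ_ X).inv).1 (he fun i => ?_))
  simpa only [tensorState_eq_comp_whiskerLeft, Category.assoc] using h i j

end TensorStates

section TensorInner

variable {C : Type u} [Category.{v} C] [DaggerCategory C] [MonoidalCategory C]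
  [SymmetricCategory C] [DaggerSymmetricMonoidal C] {X Y X' Y' : C}

theorem dag_tensorState (x : 𝟙_ C ⟶ X) (y : 𝟙_ C ⟶ Y) :
    dag (tensorState x y) = (dag x ⊗ₘ dag y) ≫ (λ_ (𝟙_ C)).hom := by
  rw [tensorState, DaggerCategory.dag_comp, DaggerSymmetricMonoidal.dag_tensor,
    (DaggerSymmetricMonoidal.leftUnitor_dag _).dag_inv]

theorem tensorState_comp_dag_tensorState (x : 𝟙_ C ⟶ X) (y : 𝟙_ C ⟶ Y) (f : X ⟶ X')
    (g : Y ⟶ Y') (x' : 𝟙_ C ⟶ X') (y' : 𝟙_ C ⟶ Y') :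
    tensorState x y ≫ (f ⊗ₘ g) ≫ dag (tensorState x' y') =
      (x ≫ f ≫ dag x') ≫ y ≫ g ≫ dag y' := by
  rw [dag_tensorState, reassoc_of% tensorState_comp, reassoc_of% tensorState_comp,
    tensorState_scalar, Category.assoc, Category.assoc, Category.assoc, Category.assoc,
    Category.assoc]

theorem IsStateBasis.tensor [HasZeroMorphisms C] [BooleanStates C] [Closed X] {ι κ : Type*}
    {e : ι → (𝟙_ C ⟶ X)} {d : κ → (𝟙_ C ⟶ Y)} (he : IsStateBasis e) (hd : IsStateBasis d) :
    IsStateBasis fun p : ι × κ => tensorState (e p.1) (d p.2) where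
  comp_dag_eq_id_iff p q := by
    have h := tensorState_comp_dag_tensorState (e p.1) (d p.2) (𝟙 X) (𝟙 Y) (e q.1) (d q.2)
    simp only [id_tensorHom_id, Category.id_comp] at h
    rw [h, BooleanStates.comp_eq_id_iff, he.comp_dag_eq_id_iff, hd.comp_dag_eq_id_iff,
      Prod.ext_iff]
  hom_ext h := tensorState_hom_ext he.hom_ext hd.hom_ext fun i j => h (i, j)

end TensorInner

section AtomTensor

variable {C : Type u} [Category.{v} C] [DaggerCategory C] [MonoidalCategory C]
  [HasZeroMorphisms C] [HasDaggerBiproducts C] [BooleanStates C]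

omit [HasZeroMorphisms C] [HasDaggerBiproducts C] [BooleanStates C] in
theorem isStateBasis_id_unit : IsStateBasis fun _ : PUnit.{v + 1} => 𝟙 (𝟙_ C) where
  comp_dag_eq_id_iff _ _ := by simp
  hom_ext h := by simpa using h

theorem atomUnit_eq_graph :
    atomUnit C = graph (X := 𝟙_ RelCat.{v}) isStateBasis_id_unit.toAtom :=
  hom_ext fun _ _ => ⟨fun h => Subtype.ext h.symm, fun h => (congrArg Subtype.val h).symm⟩

theorem isDaggerIso_atomUnit : IsDaggerIso (atomUnit C) := by
  rw [atomUnit_eq_graph]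
  exact isDaggerIso_graph isStateBasis_id_unit.bijective_toAtom

variable [HasAtomBasis C] [SymmetricCategory C] [DaggerSymmetricMonoidal C] [MonoidalClosed C]

/-- The function `(x, y) ↦ x ⊗ y` on atoms. -/
def atomPair (X Y : C) : carrier (atomSet X ⊗ atomSet Y) → carrier (atomSet (X ⊗ Y)) :=
  ((isStateBasis_val X).tensor (isStateBasis_val Y)).toAtom

variable (X Y Z : C) {X' Y' : C}

theorem atomTensor_eq_graph : atomTensor X Y = graph (atomPair X Y) :=
  hom_ext fun _ _ => ⟨fun h => Subtype.ext h.symm, fun h => (congrArg Subtype.val h).symm⟩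

theorem isDaggerIso_atomTensor : IsDaggerIso (atomTensor X Y) := by
  rw [atomTensor_eq_graph]
  exact isDaggerIso_graph ((isStateBasis_val X).tensor (isStateBasis_val Y)).bijective_toAtom

theorem atomTensor_natural {X Y : C} (f : X ⟶ X') (g : Y ⟶ Y') :
    (atomMap f ⊗ₘ atomMap g) ≫ atomTensor X' Y' = atomTensor X Y ≫ atomMap (f ⊗ₘ g) := by
  have h : atomMap f ⊗ₘ atomMap g =
      (atomTensor X Y ≫ atomMap (f ⊗ₘ g)) ≫ dag (atomTensor X' Y') := by
    simp only [atomTensor_eq_graph]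
    refine hom_ext fun p q => ?_
    rw [rel_comp_dag_graph, rel_graph_comp, rel_atomMap]
    exact BooleanStates.comp_eq_id_iff.symm.trans
      (by rw [← tensorState_comp_dag_tensorState]; rfl)
  rw [h, Category.assoc, (isDaggerIso_atomTensor X' Y').2, Category.comp_id]

theorem atomTensor_natural_left {X : C} (f : X ⟶ X') :
    atomMap f ▷ atomSet Y ≫ atomTensor X' Y = atomTensor X Y ≫ atomMap (f ▷ Y) := by
  rw [← tensorHom_id, ← tensorHom_id, ← atomTensor_natural, atomMap_id]

theorem atomTensor_natural_right {Y : C} (g : Y ⟶ Y') :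
    atomSet X ◁ atomMap g ≫ atomTensor X Y' = atomTensor X Y ≫ atomMap (X ◁ g) := by
  rw [← id_tensorHom, ← id_tensorHom, ← atomTensor_natural, atomMap_id]

theorem atomTensor_associativity :
    atomTensor X Y ▷ atomSet Z ≫ atomTensor (X ⊗ Y) Z ≫ atomMap (α_ X Y Z).hom =
      (α_ (atomSet X) (atomSet Y) (atomSet Z)).hom ≫ atomSet X ◁ atomTensor Y Z ≫
        atomTensor X (Y ⊗ Z) := by
  simp only [atomTensor_eq_graph, graph_whiskerRight, whiskerLeft_graph, graph_comp,
    ← Category.assoc]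
  exact (graph_comp_atomMap fun p => tensorState_associator p.1.1.1 p.1.2.1 p.2.1).trans
    (graph_comp (Y := atomSet X ⊗ atomSet Y ⊗ atomSet Z) _ _).symm

theorem atomTensor_left_unitality :
    (λ_ (atomSet X)).hom =
      atomUnit C ▷ atomSet X ≫ atomTensor (𝟙_ C) X ≫ atomMap (λ_ X).hom := by
  rw [atomUnit_eq_graph, atomTensor_eq_graph, graph_whiskerRight, ← Category.assoc, graph_comp]
  exact (graph_comp_atomMap fun p => tensorState_leftUnitor p.2.1).symm

theorem atomTensor_right_unitality :
    (ρ_ (atomSet X)).hom =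
      atomSet X ◁ atomUnit C ≫ atomTensor X (𝟙_ C) ≫ atomMap (ρ_ X).hom := by
  rw [atomUnit_eq_graph, atomTensor_eq_graph, whiskerLeft_graph, ← Category.assoc, graph_comp]
  exact (graph_comp_atomMap fun p => tensorState_rightUnitor p.1.1).symm

theorem atomTensor_braided :
    atomTensor X Y ≫ atomMap (β_ X Y).hom =
      (β_ (atomSet X) (atomSet Y)).hom ≫ atomTensor Y X := by
  rw [atomTensor_eq_graph, atomTensor_eq_graph]
  exact (graph_comp_atomMap fun p => tensorState_braiding p.1.1 p.2.1).trans
    (graph_comp (Y := atomSet Y ⊗ atomSet X) _ _).symm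

variable (C) in
/-- The functor of atoms as a strong symmetric monoidal functor. -/
@[reducible]
def atomFunctorBraided (hid : ∀ X : C, atomMap (𝟙 X) = 𝟙 (atomSet X))
    (hcomp : ∀ (X Y Z : C) (f : X ⟶ Y) (g : Y ⟶ Z), atomMap (f ≫ g) = atomMap f ≫ atomMap g) :
    (atomFunctor C hid hcomp).Braided :=
  letI core : (atomFunctor C hid hcomp).CoreMonoidal :=
    { εIso := isDaggerIso_atomUnit.iso
      μIso := fun X Y => (isDaggerIso_atomTensor X Y).iso
      μIso_hom_natural_left := fun f Y => atomTensor_natural_left Y f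
      μIso_hom_natural_right := fun X g => atomTensor_natural_right X g
      associativity := atomTensor_associativity
      left_unitality := atomTensor_left_unitality
      right_unitality := atomTensor_right_unitality }
  letI := core.toMonoidal
  { braided := atomTensor_braided }

end AtomTensor

/-! ### Sets and relations -/

namespace RelSets

instance : DaggerSymmetricMonoidal RelCat.{v} where
  dag_tensor _ _ := rfl
  associator_dag _ _ _ := isDaggerIso_graph (Equiv.bijective _)
  leftUnitor_dag _ := isDaggerIso_graph (Equiv.bijective _)
  rightUnitor_dag _ := isDaggerIso_graph (Equiv.bijective _)
  braiding_dag _ _ := isDaggerIso_graph (Equiv.bijective _)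

/-- The relation from the point to `X × X` whose image is the diagonal: the coevaluation of the
duality of `X` with itself. -/
def cup (X : RelCat.{v}) : 𝟙_ RelCat.{v} ⟶ X ⊗ X :=
  mk (X := 𝟙_ RelCat.{v}) (Y := X ⊗ X) fun _ p => p.1 = p.2

@[simp] theorem rel_cup (X : RelCat.{v}) (t : PUnit.{v + 1}) (p : carrier X × carrier X) :
    rel (cup X) t p ↔ p.1 = p.2 := Iff.rfl

@[simp] theorem rel_leftUnitor_inv (X : RelCat.{v}) (x : carrier X)
    (p : PUnit.{v + 1} × carrier X) : rel (λ_ X).inv x p ↔ p.2 = x := Iff.rfl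

@[simp] theorem rel_rightUnitor_inv (X : RelCat.{v}) (x : carrier X)
    (p : carrier X × PUnit.{v + 1}) : rel (ρ_ X).inv x p ↔ p.1 = x := Iff.rfl

/-- The duality of a set with itself. -/
@[reducible]
def selfPairing (X : RelCat.{v}) : ExactPairing X X where
  coevaluation' := cup X
  evaluation' := dag (cup X)
  coevaluation_evaluation' := by
    refine hom_ext ?_
    rintro ⟨x, p⟩ ⟨q, y⟩
    simp [exists_carrier_tensor, eq_comm]
  evaluation_coevaluation' := by
    refine hom_ext ?_
    rintro ⟨p, x⟩ ⟨y, q⟩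
    simp [exists_carrier_tensor, eq_comm]

theorem braiding_comp_dag_cup (X : RelCat.{v}) : (β_ X X).hom ≫ dag (cup X) = dag (cup X) :=
  hom_ext fun p _ => (rel_graph_comp Prod.swap _ p _).trans eq_comm

instance : DaggerCompactClosed RelCat.{v} where
  exists_dual X := ⟨X, selfPairing X, (braiding_comp_dag_cup X).symm⟩

section Sigma

variable {M : Type v} (X : M → RelCat.{v})

/-- The inclusion of a summand into a disjoint union. -/
def sigmaInj (m : M) : X m ⟶ of (Σ m, carrier (X m)) :=
  graph (Y := of (Σ m, carrier (X m))) (Sigma.mk m)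

variable {X}

theorem rel_sigmaInj_comp {Z : RelCat.{v}} (m : M) (f : of (Σ m, carrier (X m)) ⟶ Z)
    (x : carrier (X m)) (z : carrier Z) :
    rel (sigmaInj X m ≫ f) x z ↔ rel f (⟨m, x⟩ : Σ m, carrier (X m)) z :=
  rel_graph_comp _ f x z

theorem rel_comp_dag_sigmaInj {Z : RelCat.{v}} (m : M) (f : Z ⟶ of (Σ m, carrier (X m)))
    (z : carrier Z) (x : carrier (X m)) :
    rel (f ≫ dag (sigmaInj X m)) z x ↔ rel f z (⟨m, x⟩ : Σ m, carrier (X m)) :=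
  rel_comp_dag_graph f _ z x

variable (X)

/-- The disjoint union of a family of sets, as its dagger biproduct. -/
def sigmaBiproduct : DaggerBiproduct X where
  pt := of (Σ m, carrier (X m))
  inj := sigmaInj X
  isColimit := Cofan.IsColimit.mk _
    (fun s => mk (X := of (Σ m, carrier (X m))) fun p z => rel (s.inj p.1) p.2 z)
    (fun _ m => hom_ext (rel_sigmaInj_comp m _))
    (fun s f hf => hom_ext fun p z => by
      rw [rel_mk, ← hf p.1]
      exact (rel_sigmaInj_comp p.1 f p.2 z).symm)
  isLimit := Fan.IsLimit.mk _
    (fun s => mk (Y := of (Σ m, carrier (X m))) fun z p => rel (s.proj p.1) z p.2)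
    (fun _ m => hom_ext (rel_comp_dag_sigmaInj m _))
    (fun s f hf => hom_ext fun z p => by
      rw [rel_mk, ← hf p.1]
      exact (rel_comp_dag_sigmaInj p.1 f z p.2).symm)
  inj_dag_self m := hom_ext fun x y => by
    rw [rel_sigmaInj_comp, rel_id]
    exact eq_comm.trans (sigma_mk_injective (i := m)).eq_iff
  inj_dag_of_ne m n hmn := hom_ext fun x y => by
    rw [rel_sigmaInj_comp]
    exact ⟨fun h => hmn (congrArg Sigma.fst h).symm, False.elim⟩

instance : HasDaggerBiproducts RelCat.{v} where
  exists_biproduct X := ⟨sigmaBiproduct X⟩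

end Sigma

section Points

variable {X Y : RelCat.{v}}

theorem eq_zero_iff {f : X ⟶ Y} : f = 0 ↔ ∀ x y, ¬ rel f x y :=
  ⟨fun h _ _ hxy => by rw [h] at hxy; exact hxy,
    fun h => hom_ext fun x y => ⟨h x y, False.elim⟩⟩

/-- An element of a set, as a state. -/
def point (x : carrier X) : 𝟙_ RelCat.{v} ⟶ X :=
  graph (X := 𝟙_ RelCat.{v}) fun _ => x

theorem rel_point_comp (x : carrier X) (f : X ⟶ Y) (t : PUnit.{v + 1}) (y : carrier Y) :
    rel (point x ≫ f) t y ↔ rel f x y :=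
  rel_graph_comp _ f t y

theorem rel_comp_dag_point (f : X ⟶ Y) (y : carrier Y) (x : carrier X) (t : PUnit.{v + 1}) :
    rel (f ≫ dag (point y)) x t ↔ rel f x y :=
  rel_comp_dag_graph f _ x t

theorem point_injective : Function.Injective (point : carrier X → _) := fun x y h => by
  have hx : rel (point y) PUnit.unit x := h ▸ rfl
  exact Eq.symm hx

theorem point_ne_zero (x : carrier X) : point x ≠ 0 :=
  fun h => eq_zero_iff.1 h PUnit.unit x rfl

theorem isSeparator_tensorUnit : IsSeparator (𝟙_ RelCat.{v}) := by
  rw [isSeparator_def]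
  intro X Y f g h
  refine hom_ext fun x y => ?_
  rw [← rel_point_comp x f PUnit.unit, h, rel_point_comp]

theorem exists_rel_of_mono (f : X ⟶ Y) [Mono f] (x : carrier X) : ∃ y, rel f x y := by
  by_contra! h
  refine point_ne_zero x (zero_of_comp_mono f (eq_zero_iff.2 fun t y => ?_))
  rw [rel_point_comp]
  exact h y

theorem isIso_of_mono_of_ne_zero (f : X ⟶ 𝟙_ RelCat.{v}) [Mono f] (hf : f ≠ 0) : IsIso f := by
  have htotal (x) (t : PUnit) : rel f x t := (exists_rel_of_mono f x).elim fun _ h => h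
  have hgraph : f = graph (Y := 𝟙_ RelCat.{v}) fun _ => PUnit.unit :=
    hom_ext fun x t => iff_of_true (htotal x t) rfl
  have hinj (x y : carrier X) : x = y :=
    point_injective ((cancel_mono f).1 (hom_ext fun t t' => by
      rw [rel_point_comp, rel_point_comp]
      exact iff_of_true (htotal x t') (htotal y t')))
  obtain ⟨x⟩ : Nonempty (carrier X) := by
    by_contra hX
    exact hf (eq_zero_iff.2 fun x => (hX ⟨x⟩).elim)
  have h : IsDaggerIso f := by
    rw [hgraph]
    exact isDaggerIso_graph ⟨fun x y _ => hinj x y, fun _ => ⟨x, rfl⟩⟩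
  exact h.iso.isIso_hom

theorem simple_tensorUnit : Simple (𝟙_ RelCat.{v}) where
  mono_isIso_iff_nonzero f _ := by
    refine ⟨?_, isIso_of_mono_of_ne_zero f⟩
    rintro hf rfl
    exact eq_zero_iff.1 (isIsoZeroEquiv _ _ hf).2 PUnit.unit PUnit.unit rfl

theorem hasZeroCokernel_iff_forall_rel {t : 𝟙_ RelCat.{v} ⟶ X} :
    HasZeroCokernel t ↔ ∀ x, rel t PUnit.unit x := by
  rw [hasZeroCokernel_iff]
  constructor
  · intro h x
    by_contra hx
    have hzero : dag (point x) = 0 := h _ _ (eq_zero_iff.2 fun _ s => by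
      rw [rel_comp_dag_point]
      exact hx)
    exact eq_zero_iff.1 hzero x PUnit.unit rfl
  · exact fun h Z q hq => eq_zero_iff.2 fun x z hxz =>
      eq_zero_iff.1 hq PUnit.unit z ⟨x, h x, hxz⟩

theorem existsUnique_hasZeroCokernel (X : RelCat.{v}) :
    ∃! t : 𝟙_ RelCat.{v} ⟶ X, HasZeroCokernel t :=
  ⟨mk (X := 𝟙_ RelCat.{v}) fun _ _ => True,
    hasZeroCokernel_iff_forall_rel.2 fun _ => trivial, fun _ ht =>
      hom_ext fun _ x => iff_of_true (hasZeroCokernel_iff_forall_rel.1 ht x) trivial⟩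

end Points

/-- The decomposition of a set into the fibres of a two-valued function. -/
def pairFiberEquiv {X : Type v} (f : X → ULift.{v} Bool) :
    (Σ b, carrier (pairFamily (of {x // f x = ⟨false⟩}) (of {x // f x = ⟨true⟩}) b)) ≃ X :=
  (Equiv.sigmaCongrRight fun
    | ⟨false⟩ => Equiv.refl _
    | ⟨true⟩ => Equiv.refl _).trans (Equiv.sigmaFiberEquiv f)

open Classical in
theorem unitMorphismsFactor : UnitMorphismsFactor RelCat.{v} := fun X a => by
  let f : carrier X → ULift.{v} Bool := fun x => ⟨!decide (rel a PUnit.unit x)⟩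
  have hf (x) : f x = ⟨false⟩ ↔ rel a PUnit.unit x := by simp [f]
  obtain ⟨t, ht, -⟩ := existsUnique_hasZeroCokernel (of {x // f x = ⟨false⟩})
  let P : BinaryDaggerBiproduct (of {x // f x = ⟨false⟩}) (of {x // f x = ⟨true⟩}) :=
    sigmaBiproduct _
  refine ⟨_, _, P, graph (X := P.pt) (pairFiberEquiv f), t,
    isDaggerIso_graph (pairFiberEquiv f).bijective, ht, hom_ext fun (_ : PUnit) x => ?_⟩
  have hinc : P.inc₁ ≫ graph (X := P.pt) (pairFiberEquiv f) =
      graph (X := of {x // f x = ⟨false⟩}) Subtype.val := graph_comp _ _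
  rw [hinc, ← hf]
  exact ⟨fun hx => ⟨⟨x, hx⟩, hasZeroCokernel_iff_forall_rel.1 ht _, rfl⟩,
    fun ⟨y, _, (hy : y.1 = x)⟩ => hy ▸ y.2⟩

end RelSets

/-! ### The equivalence -/

/-- The closed structure of a dagger compact closed category, given by a choice of duals. -/
@[reducible]
noncomputable def DaggerCompactClosed.monoidalClosed (C : Type u) [Category.{v} C]
    [DaggerCategory C] [MonoidalCategory C] [SymmetricCategory C] [DaggerCompactClosed C] :
    MonoidalClosed C where
  closed X :=
    letI : HasLeftDual X :=
      { leftDual := _, exact := (DaggerCompactClosed.exists_dual X).choose_spec.choose }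
    closedOfHasLeftDual X

theorem corollary2_general (C : Type u) [Category.{v} C] [DaggerCategory C] [MonoidalCategory C]
    [SymmetricCategory C] [DaggerSymmetricMonoidal C] [MonoidalClosed C] [HasZeroMorphisms C]
    [HasDaggerBiproducts C] (hsimple : Simple (𝟙_ C)) (hsep : IsSeparator (𝟙_ C))
    (htop : ∀ X : C, ∃! t : 𝟙_ C ⟶ X, HasZeroCokernel t) (hfac : UnitMorphismsFactor C) :
    ∃ (hid : ∀ X : C, atomMap (𝟙 X) = 𝟙 (atomSet X))
      (hcomp : ∀ (X Y Z : C) (f : X ⟶ Y) (g : Y ⟶ Z),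
        atomMap (f ≫ g) = atomMap f ≫ atomMap g),
      IsDaggerEquivalence (atomFunctor C hid hcomp) ∧
      ∃ _ : (atomFunctor C hid hcomp).Braided,
        Functor.LaxMonoidal.ε (atomFunctor C hid hcomp) = atomUnit C ∧
        (∀ X Y : C, Functor.LaxMonoidal.μ (atomFunctor C hid hcomp) X Y = atomTensor X Y) ∧
        IsDaggerIso (Functor.LaxMonoidal.ε (atomFunctor C hid hcomp)) ∧
        (∀ X Y : C, IsDaggerIso (Functor.LaxMonoidal.μ (atomFunctor C hid hcomp) X Y)) := by
  have : BooleanStates C := booleanStates_of_unitMorphismsFactor (htop _) hfac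
  have : HasAtomBasis C := hasAtomBasis_of_unitMorphismsFactor hsep htop hfac
  exact ⟨atomMap_id, fun _ _ _ => atomMap_comp, isDaggerEquivalence_atomFunctor _ _,
    atomFunctorBraided C _ _, rfl, fun _ _ => rfl, isDaggerIso_atomUnit, isDaggerIso_atomTensor⟩

/-- In the first part, the morphisms with zero cokernel in the hypotheses are the `⊤_X`, and `E` is
the functor of atoms; the relations `atomUnit` and `atomTensor` are its monoidal structure. -/
theorem corollary2 :
    (∀ (C : Type u) [Category.{v} C] [DaggerCategory C] [MonoidalCategory C]
        [SymmetricCategory C] [DaggerCompactClosed C] [HasZeroMorphisms C]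
        [HasDaggerBiproducts C],
      Simple (𝟙_ C) → IsSeparator (𝟙_ C) →
      (∀ X : C, ∃! t : 𝟙_ C ⟶ X, HasZeroCokernel t) →
      UnitMorphismsFactor C →
      ∃ (hid : ∀ X : C, atomMap (𝟙 X) = 𝟙 (atomSet X))
        (hcomp : ∀ (X Y Z : C) (f : X ⟶ Y) (g : Y ⟶ Z),
          atomMap (f ≫ g) = atomMap f ≫ atomMap g),
        IsDaggerEquivalence (atomFunctor C hid hcomp) ∧
        ∃ _ : (atomFunctor C hid hcomp).Braided,
          Functor.LaxMonoidal.ε (atomFunctor C hid hcomp) = atomUnit C ∧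
          (∀ X Y : C, Functor.LaxMonoidal.μ (atomFunctor C hid hcomp) X Y = atomTensor X Y) ∧
          IsDaggerIso (Functor.LaxMonoidal.ε (atomFunctor C hid hcomp)) ∧
          (∀ X Y : C, IsDaggerIso (Functor.LaxMonoidal.μ (atomFunctor C hid hcomp) X Y))) ∧
    (DaggerCompactClosed RelCat.{v} ∧ HasDaggerBiproducts RelCat.{v} ∧
      Simple (𝟙_ RelCat.{v}) ∧ IsSeparator (𝟙_ RelCat.{v}) ∧
      (∀ X : RelCat.{v}, ∃! t : 𝟙_ RelCat.{v} ⟶ X, HasZeroCokernel t) ∧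
      UnitMorphismsFactor RelCat.{v}) :=
  ⟨fun C _ _ _ _ _ _ _ =>
    letI := DaggerCompactClosed.monoidalClosed C
    corollary2_general C,
  inferInstance, inferInstance, RelSets.simple_tensorUnit, RelSets.isSeparator_tensorUnit,
  RelSets.existsUnique_hasZeroCokernel, RelSets.unitMorphismsFactor⟩
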